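/- Let $d,N\in\mathbb{N}$ with $N\ge 1$. For a finite set $\Lambda\subset\mathbb{Z}^d$ let $\mathcal{A}_\Lambda=\bigotimes_{x\in\Lambda}M_N(\mathbb{C})$ be the algebra of operators on $\bigotimes_{x\in\Lambda}\mathbb{C}^N$ with the operator norm, where $A\in\mathcal{A}_\Lambda$ is identified with $A\otimes 1\in\mathcal{A}_{\Lambda'}$ for $\Lambda\subset\Lambda'$; let $\mathcal{A}_0=\bigcup_\Lambda\mathcal{A}_\Lambda$ be the algebra of local observables and let the $C^*$-algebra $\mathcal{A}$ of quasi-local observables be its norm completion. Let $\Phi=(\Phi_X)$ be an interaction, that is, a family of hermitian operators $\Phi_X\in\mathcal{A}_X$ indexed by the finite sets $X\subset\mathbb{Z}^d$; for $r\ge1$ set $$\|\Phi\|_r=\sup_{x\in\mathbb{Z}^d}\sum_{X\ni x}\|\Phi_X\|\,r^{|X|}\in[0,\infty],$$ and assume that $\|\Phi\|_r<\infty$ for some $r>1$. For finite $\Lambda$ put $H_\Lambda=\sum_{X\subset\Lambda}\Phi_X$ and $\alpha^\Lambda_t(A)=e^{itH_\Lambda}Ae^{-itH_\Lambda}$. Let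 $\beta\ge0$ and suppose that $$\beta\,\|\Phi\|_{N+1}<\frac1{2N},$$ or, more generally, that $2\beta\,\|\Phi\|_{N(1+s)}<s$ for some $s<1/N$. Then there is exactly one one-parameter group $(\alpha_t)_{t\in\mathbb{R}}$ of $*$-automorphisms of $\mathcal{A}$ such that $\|\alpha_t^{\Lambda_n}(A)-\alpha_t(A)\|\to0$ for all $t\in\mathbb{R}$, all $A\in\mathcal{A}_0$ and all sequences $(\Lambda_n)$ of finite sets such that every finite set is contained in $\Lambda_n$ for all large $n$; and there is exactly one KMS state for $(\alpha_t)$ at inverse temperature $\beta$. Here a KMS state at inverse temperature $\beta$ is a bounded, positive, normalized linear functional $\rho$ on $\mathcal{A}$ such that, for every $A\in\mathcal{A}_0$, the function $t\mapsto\alpha_t(A)$ has an analytic continuation to a neighbourhood of the strip $0\le\operatorname{Im}z\le\beta$, and its value $\alpha_{i\beta}(A)$ at $i\beta$ satisfies $\rho(AB)=\rho(B\,\alpha_{i\beta}(A))$ for all $B\in\mathcal{A}_0$. -/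

import Mathlib

open scoped NNReal ENNReal

noncomputable section

namespace QuantumLattice

open scoped Kronecker Matrix.Norms.L2Operator ComplexOrder
open UniformSpace Filter Topology

universe u

variable {L : Type u} [DecidableEq L] {N : ℕ}

/-- The algebra `𝒜_Λ` of all operators on `⨂_{x ∈ Λ} ℂ^N`, as matrices in the product basis, which is
indexed by the configurations `Λ → Fin N`. It carries the operator norm. -/
abbrev BoxAlgebra (N : ℕ) (Λ : Finset L) : Type u :=
  Matrix (Λ → Fin N) (Λ → Fin N) ℂ

/-- A configuration in `Λ'` is a configuration in `Λ ⊆ Λ'` and one in `Λ' \ Λ`. -/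
def splitConfig {Λ Λ' : Finset L} (h : Λ ≤ Λ') :
    (Λ' → Fin N) ≃ (Λ → Fin N) × ({x : Λ' // x.1 ∉ Λ} → Fin N) where
  toFun σ := (fun x => σ ⟨x.1, h x.2⟩, fun x => σ x.1)
  invFun p x := if hx : x.1 ∈ Λ then p.1 ⟨x.1, hx⟩ else p.2 ⟨x, hx⟩
  left_inv σ := by
    funext x
    by_cases hx : x.1 ∈ Λ <;> simp [hx]
  right_inv p := by
    refine Prod.ext ?_ ?_
    · funext x
      simp
    · funext x
      simp [x.2]

/-- The inclusion `𝒜_Λ → 𝒜_Λ'`, `A ↦ A ⊗ 1`, for `Λ ⊆ Λ'`. -/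
def extend {Λ Λ' : Finset L} (h : Λ ≤ Λ') : BoxAlgebra N Λ →⋆ₐ[ℂ] BoxAlgebra N Λ' where
  toFun A := (A ⊗ₖ (1 : Matrix ({x : Λ' // x.1 ∉ Λ} → Fin N) _ ℂ)).submatrix
    (splitConfig h) (splitConfig h)
  map_one' := by
    rw [Matrix.one_kronecker_one, Matrix.submatrix_one_equiv]
  map_mul' A B := by
    rw [Matrix.submatrix_mul_equiv, ← Matrix.mul_kronecker_mul, one_mul]
  map_zero' := by
    rw [Matrix.zero_kronecker]; rfl
  map_add' A B := by
    rw [Matrix.add_kronecker]; rfl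
  commutes' c := by
    simp only [Algebra.algebraMap_eq_smul_one, Matrix.smul_kronecker, Matrix.one_kronecker_one]
    ext σ τ
    simp [Matrix.one_apply]
  map_star' A := by
    rw [Matrix.star_eq_conjTranspose, Matrix.star_eq_conjTranspose, Matrix.conjTranspose_submatrix,
      Matrix.conjTranspose_kronecker, Matrix.conjTranspose_one]

theorem extend_apply {Λ Λ' : Finset L} (h : Λ ≤ Λ') (A : BoxAlgebra N Λ) (σ τ : Λ' → Fin N) :
    extend h A σ τ =
      if ∀ x : Λ', x.1 ∉ Λ → σ x = τ x then
        A (fun x => σ ⟨x.1, h x.2⟩) (fun x => τ ⟨x.1, h x.2⟩) else 0 := by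
  have : ((fun x : {x : Λ' // x.1 ∉ Λ} => σ x.1) = fun x => τ x.1) ↔
      ∀ x : Λ', x.1 ∉ Λ → σ x = τ x := by
    rw [funext_iff]; simp
  change (A ⊗ₖ (1 : Matrix ({x : Λ' // x.1 ∉ Λ} → Fin N) _ ℂ))
    (splitConfig h σ) (splitConfig h τ) = _
  simp only [Matrix.kroneckerMap_apply, splitConfig, Equiv.coe_fn_mk,
    Matrix.one_apply, this, mul_ite, mul_one, mul_zero]

instance : DirectedSystem (fun Λ : Finset L => BoxAlgebra N Λ) fun _ _ h => extend h where
  map_self Λ A := by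
    ext σ τ
    rw [extend_apply, if_pos (fun x hx => absurd x.2 hx)]
  map_map Λ₃ Λ₂ Λ₁ h₁ h₂ A := by
    ext σ τ
    simp only [extend_apply]
    by_cases hσ : ∀ x : Λ₃, x.1 ∉ Λ₁ → σ x = τ x
    · rw [if_pos hσ, if_pos (fun x hx => hσ x fun h => hx (h₁ h))]
      exact if_pos fun (x : Λ₂) hx => hσ ⟨x.1, h₂ x.2⟩ hx
    · rw [if_neg hσ]
      split_ifs with h₃ h₄
      · refine absurd (fun x hx => ?_) hσ
        by_cases hx2 : x.1 ∈ Λ₂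
        · exact h₄ ⟨x.1, hx2⟩ hx
        · exact h₃ x hx2
      · rfl
      · rfl

theorem extend_injective [NeZero N] {Λ Λ' : Finset L} (h : Λ ≤ Λ') :
    Function.Injective (extend (N := N) h) := by
  intro A B hAB
  ext σ τ
  have key := congrFun (congrFun hAB ((splitConfig h).symm (σ, fun _ => 0)))
    ((splitConfig h).symm (τ, fun _ => 0))
  change (A ⊗ₖ (1 : Matrix ({x : Λ' // x.1 ∉ Λ} → Fin N) _ ℂ))
      (splitConfig h _) (splitConfig h _) =
    (B ⊗ₖ (1 : Matrix ({x : Λ' // x.1 ∉ Λ} → Fin N) _ ℂ)) (splitConfig h _) (splitConfig h _)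
    at key
  simpa [Matrix.kroneckerMap_apply] using key

theorem norm_extend [NeZero N] {Λ Λ' : Finset L} (h : Λ ≤ Λ') (A : BoxAlgebra N Λ) :
    ‖extend h A‖ = ‖A‖ :=
  NonUnitalStarAlgHom.norm_map (extend h) (extend_injective h) A

/-- The algebra `𝒜₀ = ⋃_Λ 𝒜_Λ` of local observables: the direct limit of the algebras `𝒜_Λ` over
the finite sets `Λ`, with `A ∈ 𝒜_Λ` identified with `A ⊗ 1 ∈ 𝒜_Λ'` for `Λ ⊆ Λ'`. -/
def LocalAlgebra (L : Type u) [DecidableEq L] (N : ℕ) : Type u :=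
  DirectLimit (fun Λ : Finset L => BoxAlgebra N Λ) fun _ _ h => extend h

namespace LocalAlgebra

instance : Ring (LocalAlgebra L N) :=
  inferInstanceAs (Ring (DirectLimit (fun Λ : Finset L => BoxAlgebra N Λ) fun _ _ h => extend h))

instance : StarRing (LocalAlgebra L N) where
  star := (star : DirectLimit (fun Λ : Finset L => BoxAlgebra N Λ) (fun _ _ h => extend h) → _)
  star_involutive := star_involutive (R := DirectLimit (fun Λ : Finset L => BoxAlgebra N Λ) _)
  star_mul := star_mul (R := DirectLimit (fun Λ : Finset L => BoxAlgebra N Λ) _)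
  star_add := star_add (R := DirectLimit (fun Λ : Finset L => BoxAlgebra N Λ) _)

instance : Module ℂ (LocalAlgebra L N) :=
  inferInstanceAs (Module ℂ
    (DirectLimit (fun Λ : Finset L => BoxAlgebra N Λ) fun _ _ h => extend h))

/-- The canonical map `𝒜_Λ → 𝒜₀`. -/
def mk (Λ : Finset L) (A : BoxAlgebra N Λ) : LocalAlgebra L N :=
  (⟦⟨Λ, A⟩⟧ : DirectLimit (fun Λ : Finset L => BoxAlgebra N Λ) fun _ _ h => extend h)

theorem mk_extend {Λ Λ' : Finset L} (h : Λ ≤ Λ') (A : BoxAlgebra N Λ) :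
    mk Λ' (extend h A) = mk Λ A :=
  DirectLimit.mk_apply (f := fun _ _ h => extend h) Λ Λ' A h

theorem mk_add (Λ : Finset L) (A B : BoxAlgebra N Λ) : mk Λ (A + B) = mk Λ A + mk Λ B :=
  (DirectLimit.add_def (f := fun _ _ h => extend h) Λ A B).symm

theorem mk_mul (Λ : Finset L) (A B : BoxAlgebra N Λ) : mk Λ (A * B) = mk Λ A * mk Λ B :=
  (DirectLimit.mul_def (f := fun _ _ h => extend h) Λ A B).symm

theorem mk_zero (Λ : Finset L) : mk Λ (0 : BoxAlgebra N Λ) = 0 :=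
  (DirectLimit.zero_def (f := fun _ _ h => extend h) Λ).symm

theorem mk_one (Λ : Finset L) : mk Λ (1 : BoxAlgebra N Λ) = 1 :=
  (DirectLimit.one_def (f := fun _ _ h => extend h) Λ).symm

theorem mk_neg (Λ : Finset L) (A : BoxAlgebra N Λ) : mk Λ (-A) = -mk Λ A :=
  (DirectLimit.neg_def (f := fun _ _ h => extend h) Λ A).symm

theorem mk_star (Λ : Finset L) (A : BoxAlgebra N Λ) : mk Λ (star A) = star (mk Λ A) := rfl

theorem mk_smul (Λ : Finset L) (c : ℂ) (A : BoxAlgebra N Λ) : mk Λ (c • A) = c • mk Λ A := rfl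

theorem exists_mk₂ (a b : LocalAlgebra L N) : ∃ Λ A B, a = mk Λ A ∧ b = mk Λ B :=
  DirectLimit.exists_eq_mk₂ (fun _ _ h => extend h) a b

theorem exists_mk (a : LocalAlgebra L N) : ∃ Λ A, a = mk Λ A :=
  DirectLimit.exists_eq_mk (fun _ _ h => extend h) a

instance : Algebra ℂ (LocalAlgebra L N) :=
  Algebra.ofModule
    (fun c a b => by
      obtain ⟨Λ, A, B, rfl, rfl⟩ := exists_mk₂ a b
      rw [← mk_smul, ← mk_mul, ← mk_mul, ← mk_smul, smul_mul_assoc])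
    (fun c a b => by
      obtain ⟨Λ, A, B, rfl, rfl⟩ := exists_mk₂ a b
      rw [← mk_smul, ← mk_mul, ← mk_mul, ← mk_smul, mul_smul_comm])

instance : StarModule ℂ (LocalAlgebra L N) where
  star_smul c a := by
    obtain ⟨Λ, A, rfl⟩ := exists_mk a
    rw [← mk_smul, ← mk_star, ← mk_star, ← mk_smul, star_smul]

variable [NeZero N]

/-- The norm of `A ∈ 𝒜_Λ ⊆ 𝒜₀` is its operator norm. -/
instance : Norm (LocalAlgebra L N) where
  norm := DirectLimit.lift (fun _ _ h => extend h) (fun _ A => ‖A‖)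
    fun _ _ h A => (norm_extend h A).symm

theorem norm_mk (Λ : Finset L) (A : BoxAlgebra N Λ) : ‖mk Λ A‖ = ‖A‖ := rfl

instance : NormedAddCommGroup (LocalAlgebra L N) :=
  AddGroupNorm.toNormedAddCommGroup
    { toFun := norm
      map_zero' := by rw [← mk_zero ∅, norm_mk, norm_zero]
      add_le' := fun a b => by
        obtain ⟨Λ, A, B, rfl, rfl⟩ := exists_mk₂ a b
        simpa only [← mk_add, norm_mk] using norm_add_le A B
      neg' := fun a => by
        obtain ⟨Λ, A, rfl⟩ := exists_mk a
        simp only [← mk_neg, norm_mk, norm_neg]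
      eq_zero_of_map_eq_zero' := fun a h => by
        obtain ⟨Λ, A, rfl⟩ := exists_mk a
        rw [norm_mk, norm_eq_zero] at h
        rw [h, mk_zero] }

instance : NormedRing (LocalAlgebra L N) where
  __ : NormedAddCommGroup (LocalAlgebra L N) := inferInstance
  __ : Ring (LocalAlgebra L N) := inferInstance
  norm_mul_le a b := by
    obtain ⟨Λ, A, B, rfl, rfl⟩ := exists_mk₂ a b
    rw [← mk_mul]
    exact norm_mul_le A B

instance : NormedAlgebra ℂ (LocalAlgebra L N) where
  norm_smul_le c a := by
    obtain ⟨Λ, A, rfl⟩ := exists_mk a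
    rw [← mk_smul]
    exact norm_smul_le c A

instance : CStarRing (LocalAlgebra L N) where
  norm_mul_self_le a := by
    obtain ⟨Λ, A, rfl⟩ := exists_mk a
    rw [← mk_star, ← mk_mul]
    exact CStarRing.norm_mul_self_le A

end LocalAlgebra

section Completion

variable {A : Type u} [NormedRing A] [StarRing A]

theorem continuous_completion_star :
    Continuous (Completion.map (star : A → A)) :=
  Completion.continuous_map

variable [CStarRing A]

theorem completion_star_coe (a : A) :
    Completion.map (star : A → A) (a : Completion A) = ((star a : A) : Completion A) :=
  Completion.map_coe star_isometry.uniformContinuous a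

variable [NormedAlgebra ℂ A] [StarModule ℂ A]

/-- The completion of a pre-C⋆-algebra `A`; the product and the scalar multiplication are those of
the completion, and the adjoint is the continuous extension of the adjoint on `A`. -/
@[reducible] def completionCStarAlgebra : CStarAlgebra (Completion A) where
  __ : NormedRing (Completion A) := inferInstance
  __ : Algebra ℂ (Completion A) := Algebra.ofModule
    (fun c a b => by
      induction a, b using Completion.induction_on₂ with
      | hp =>
        exact isClosed_eq ((continuous_fst.const_smul c).mul continuous_snd)
          ((continuous_fst.mul continuous_snd).const_smul c)
      | ih a b =>
        rw [← Completion.coe_smul, ← Completion.coe_mul, ← Completion.coe_mul,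
          ← Completion.coe_smul, smul_mul_assoc])
    (fun c a b => by
      induction a, b using Completion.induction_on₂ with
      | hp =>
        exact isClosed_eq (continuous_fst.mul (continuous_snd.const_smul c))
          ((continuous_fst.mul continuous_snd).const_smul c)
      | ih a b =>
        rw [← Completion.coe_smul, ← Completion.coe_mul, ← Completion.coe_mul,
          ← Completion.coe_smul, mul_smul_comm])
  toCompleteSpace := inferInstance
  star := Completion.map (star : A → A)
  star_involutive a := by
    induction a using Completion.induction_on with
    | hp =>
      exact isClosed_eq (continuous_completion_star.comp continuous_completion_star) continuous_id
    | ih a => rw [completion_star_coe, completion_star_coe, star_star]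
  star_mul a b := by
    change Completion.map star (a * b) = Completion.map star b * Completion.map star a
    induction a, b using Completion.induction_on₂ with
    | hp =>
      exact isClosed_eq (continuous_completion_star.comp (continuous_fst.mul continuous_snd))
        ((continuous_completion_star.comp continuous_snd).mul
          (continuous_completion_star.comp continuous_fst))
    | ih a b =>
      rw [← Completion.coe_mul, completion_star_coe, completion_star_coe, completion_star_coe,
        ← Completion.coe_mul, star_mul]
  star_add a b := by
    change Completion.map star (a + b) = Completion.map star a + Completion.map star b
    induction a, b using Completion.induction_on₂ with
    | hp =>
      exact isClosed_eq (continuous_completion_star.comp (continuous_fst.add continuous_snd))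
        ((continuous_completion_star.comp continuous_fst).add
          (continuous_completion_star.comp continuous_snd))
    | ih a b =>
      rw [← Completion.coe_add, completion_star_coe, completion_star_coe, completion_star_coe,
        ← Completion.coe_add, star_add]
  norm_smul_le := norm_smul_le
  norm_mul_self_le a := by
    change ‖a‖ * ‖a‖ ≤ ‖Completion.map star a * a‖
    induction a using Completion.induction_on with
    | hp =>
      exact isClosed_le (continuous_norm.mul continuous_norm)
        (continuous_completion_star.mul continuous_id).norm
    | ih a =>
      rw [completion_star_coe, ← Completion.coe_mul, Completion.norm_coe, Completion.norm_coe]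
      exact CStarRing.norm_mul_self_le a
  star_smul c a := by
    change Completion.map star (c • a) = star c • Completion.map star a
    induction a using Completion.induction_on with
    | hp =>
      exact isClosed_eq (continuous_completion_star.comp (continuous_id.const_smul c))
        (continuous_completion_star.const_smul (star c))
    | ih a =>
      rw [← Completion.coe_smul, completion_star_coe, completion_star_coe, ← Completion.coe_smul,
        star_smul]

end Completion

/-- The C⋆-algebra `𝒜` of quasi-local observables: the norm completion of `𝒜₀`. -/
def QuasiLocalAlgebra (L : Type u) [DecidableEq L] (N : ℕ) [NeZero N] : Type u :=
  Completion (LocalAlgebra L N)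

namespace QuasiLocalAlgebra

variable [NeZero N]

instance : CStarAlgebra (QuasiLocalAlgebra L N) :=
  completionCStarAlgebra (A := LocalAlgebra L N)

/-- The inclusion `𝒜₀ → 𝒜`. -/
def ofLocal (a : LocalAlgebra L N) : QuasiLocalAlgebra L N :=
  (a : Completion (LocalAlgebra L N))

theorem denseRange_ofLocal :
    DenseRange (ofLocal : LocalAlgebra L N → QuasiLocalAlgebra L N) :=
  Completion.denseRange_coe (α := LocalAlgebra L N)

theorem ofLocal_mul (a b : LocalAlgebra L N) : ofLocal (a * b) = ofLocal a * ofLocal b :=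
  Completion.coe_mul a b

theorem ofLocal_add (a b : LocalAlgebra L N) : ofLocal (a + b) = ofLocal a + ofLocal b :=
  Completion.coe_add a b

theorem ofLocal_one : ofLocal (1 : LocalAlgebra L N) = 1 := rfl

theorem ofLocal_zero : ofLocal (0 : LocalAlgebra L N) = 0 := rfl

theorem ofLocal_smul (c : ℂ) (a : LocalAlgebra L N) : ofLocal (c • a) = c • ofLocal a :=
  Completion.coe_smul c a

theorem ofLocal_star (a : LocalAlgebra L N) : ofLocal (star a) = star (ofLocal a) :=
  (completion_star_coe a).symm

theorem norm_ofLocal (a : LocalAlgebra L N) : ‖ofLocal a‖ = ‖a‖ :=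
  Completion.norm_coe a

end QuasiLocalAlgebra

section Dynamics

variable [NeZero N]

/-- The inclusion `𝒜_Λ → 𝒜`. -/
def incl (Λ : Finset L) : BoxAlgebra N Λ →⋆ₐ[ℂ] QuasiLocalAlgebra L N where
  toFun A := QuasiLocalAlgebra.ofLocal (LocalAlgebra.mk Λ A)
  map_one' := by rw [LocalAlgebra.mk_one, QuasiLocalAlgebra.ofLocal_one]
  map_mul' A B := by rw [LocalAlgebra.mk_mul, QuasiLocalAlgebra.ofLocal_mul]
  map_zero' := by rw [LocalAlgebra.mk_zero, QuasiLocalAlgebra.ofLocal_zero]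
  map_add' A B := by rw [LocalAlgebra.mk_add, QuasiLocalAlgebra.ofLocal_add]
  commutes' c := by
    rw [Algebra.algebraMap_eq_smul_one, LocalAlgebra.mk_smul, LocalAlgebra.mk_one,
      QuasiLocalAlgebra.ofLocal_smul, QuasiLocalAlgebra.ofLocal_one,
      Algebra.algebraMap_eq_smul_one]
  map_star' A := by rw [LocalAlgebra.mk_star, QuasiLocalAlgebra.ofLocal_star]

theorem norm_incl (Λ : Finset L) (A : BoxAlgebra N Λ) : ‖incl Λ A‖ = ‖A‖ :=
  QuasiLocalAlgebra.norm_ofLocal (LocalAlgebra.mk Λ A)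

theorem incl_extend {Λ Λ' : Finset L} (h : Λ ≤ Λ') (A : BoxAlgebra N Λ) :
    incl Λ' (extend h A) = incl Λ A :=
  congrArg QuasiLocalAlgebra.ofLocal (LocalAlgebra.mk_extend h A)

/-- The set of local observables, as elements of `𝒜`. -/
def localObservables (L : Type u) [DecidableEq L] (N : ℕ) [NeZero N] :
    Set (QuasiLocalAlgebra L N) :=
  Set.range QuasiLocalAlgebra.ofLocal

/-- An interaction: a hermitian operator `Φ_X ∈ 𝒜_X` for every finite set `X` of sites. -/
structure Interaction (L : Type u) [DecidableEq L] (N : ℕ) where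
  /-- the operator `Φ_X` -/
  op : (X : Finset L) → BoxAlgebra N X
  isHermitian : ∀ X, (op X).IsHermitian

/-- `‖Φ‖_r = sup_x ∑_{X ∋ x} ‖Φ_X‖ r^|X|`, possibly infinite. -/
def Interaction.norm (Φ : Interaction L N) (r : ℝ≥0) : ℝ≥0∞ :=
  ⨆ x : L, ∑' X : {X : Finset L // x ∈ X}, ‖Φ.op X.1‖ₑ * (r : ℝ≥0∞) ^ X.1.card

/-- The Hamiltonian `H_Λ = ∑_{X ⊆ Λ} Φ_X`. -/
def Interaction.hamiltonian (Φ : Interaction L N) (Λ : Finset L) : QuasiLocalAlgebra L N :=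
  ∑ X ∈ Λ.powerset, incl X (Φ.op X)

/-- The finite-volume time evolution `α_t^Λ(A) = e^{itH_Λ} A e^{-itH_Λ}`. -/
def Interaction.boxEvolution (Φ : Interaction L N) (Λ : Finset L) (t : ℂ)
    (A : QuasiLocalAlgebra L N) : QuasiLocalAlgebra L N :=
  NormedSpace.exp ((Complex.I * t) • Φ.hamiltonian Λ) * A *
    NormedSpace.exp (-((Complex.I * t) • Φ.hamiltonian Λ))

/-- `α` is the infinite-volume time evolution of `Φ`: a one-parameter group of `⋆`-automorphisms
of `𝒜` such that `α_t^{Λ_n}(A) → α_t(A)` in norm for all `t`, every local `A` and every sequence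
`Λ_n` of finite sets that eventually contain any given finite set. -/
structure Interaction.IsTimeEvolution (Φ : Interaction L N)
    (α : ℝ → (QuasiLocalAlgebra L N ≃⋆ₐ[ℂ] QuasiLocalAlgebra L N)) : Prop where
  map_zero : ∀ A, α 0 A = A
  map_add : ∀ s t A, α (s + t) A = α s (α t A)
  tendsto : ∀ Λ : ℕ → Finset L, Tendsto Λ atTop atTop →
    ∀ t : ℝ, ∀ A ∈ localObservables L N,
      Tendsto (fun n => Φ.boxEvolution (Λ n) t A) atTop (𝓝 (α t A))

/-- A state: a bounded, positive, normalized linear functional on `𝒜`. -/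
structure IsState (ρ : QuasiLocalAlgebra L N →L[ℂ] ℂ) : Prop where
  nonneg : ∀ A, 0 ≤ ρ (star A * A)
  map_one : ρ 1 = 1

/-- `W = α_{iβ}(A)`: the function `t ↦ α_t(A)` on `ℝ` has an analytic continuation `f` to a
neighbourhood of the strip `0 ≤ Im z ≤ β`, and `f(iβ) = W`. (By the identity theorem there is at
most one such `W`.) -/
def IsEvolutionAtImaginaryTime (α : ℝ → (QuasiLocalAlgebra L N ≃⋆ₐ[ℂ] QuasiLocalAlgebra L N))
    (β : ℝ) (A W : QuasiLocalAlgebra L N) : Prop :=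
  ∃ f : ℂ → QuasiLocalAlgebra L N,
    AnalyticOnNhd ℂ f {z : ℂ | 0 ≤ z.im ∧ z.im ≤ β} ∧
      (∀ t : ℝ, f t = α t A) ∧ f (Complex.I * β) = W

/-- `ρ` is a KMS state at inverse temperature `β`: a state such that `α_{iβ}(A)` is defined and
`ρ(A B) = ρ(B α_{iβ}(A))` for all local `A`, `B`. -/
structure IsKMSState (α : ℝ → (QuasiLocalAlgebra L N ≃⋆ₐ[ℂ] QuasiLocalAlgebra L N))
    (β : ℝ) (ρ : QuasiLocalAlgebra L N →L[ℂ] ℂ) : Prop where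
  isState : IsState ρ
  kms : ∀ A ∈ localObservables L N, ∃ W, IsEvolutionAtImaginaryTime α β A W ∧
    ∀ B ∈ localObservables L N, ρ (A * B) = ρ (B * W)

end Dynamics

end QuantumLattice

end

/-!
The commutators of the Hamiltonians with `A ∈ 𝒜_Y` are controlled by the scalar majorant
`t ↦ (1 + κ t)^|Y|`, in any seminorm `p` for which commuting with `Φ_X` is bounded by `c X`, where
`κ` bounds `sup_x ∑_{X ∋ x} c X * r ^ |X|`. In the operator norm this makes `α_z^Λ(A)` converge for
`|z| < (r - 1) / κ`; the group property and the isometry of `α_t^Λ` for real `t` extend the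
convergence to all real times and to the strip `|Im z| < (r - 1) / κ`. A weak-⋆ limit of the Gibbs
states is then a KMS state.

For uniqueness, let `D` be the difference of two KMS states and let `p` be the seminorm
`p(b) = sup |D(u b v)|` over Weyl operators `u` and `v`. If the Weyl operator `e` is not scalar at
some site, then `∑_u u e u* = 0` over the Weyl operators `u` of that site, while the KMS condition
gives `D(u e u*) - D(e) = D(e u* (α_{iβ}(u) - u))`, which is at most
`p(α_{iβ}(u) - u) ≤ κ β p(1)` in absolute value. Hence `p(1) ≤ κ β p(1)` with `κ β < 1`, so
`D = 0`. As `Φ_X` is a combination of Weyl operators, the bound `c X` for `p` has an additional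
factor `N^|X|`, which is where the temperature condition comes from.
-/

noncomputable section

namespace QuantumLattice

open scoped NNReal ENNReal Kronecker Matrix.Norms.L2Operator ComplexOrder CStarAlgebra
open UniformSpace Filter Topology

universe u

section PowerSeries

theorem hasDerivAt_sum_pow_div_factorial (c : ℕ → ℝ) (M : ℕ) (t : ℝ) :
    HasDerivAt (fun t : ℝ => ∑ n ∈ Finset.range (M + 1), t ^ n / n.factorial * c n)
      (∑ n ∈ Finset.range M, t ^ n / n.factorial * c (n + 1)) t := by
  have hderiv := HasDerivAt.fun_sum fun n (_ : n ∈ Finset.range (M + 1)) =>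
    ((hasDerivAt_pow n t).div_const (n.factorial : ℝ)).mul_const (c n)
  rw [Finset.sum_range_succ'] at hderiv
  refine hderiv.congr_deriv ?_
  simp [Nat.factorial_succ, mul_div_mul_left _ _ (Nat.cast_add_one_ne_zero (R := ℝ) _)]

theorem sum_pow_div_factorial_le_of_deriv_le {c : ℕ → ℝ} {M : ℕ} {g g' : ℝ → ℝ} {T : ℝ}
    (hT : 0 ≤ T) (hg : ∀ t, HasDerivAt g (g' t) t) (h0 : c 0 ≤ g 0)
    (hle : ∀ t, 0 ≤ t → t ≤ T → ∑ n ∈ Finset.range M, t ^ n / n.factorial * c (n + 1) ≤ g' t) :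
    ∑ n ∈ Finset.range (M + 1), T ^ n / n.factorial * c n ≤ g T := by
  have hf := hasDerivAt_sum_pow_div_factorial c M
  refine image_le_of_deriv_right_le_deriv_boundary
    (fun t _ => (hf t).continuousAt.continuousWithinAt) (fun t _ => (hf t).hasDerivWithinAt) ?_
    (fun t _ => (hg t).continuousAt.continuousWithinAt) (fun t _ => (hg t).hasDerivWithinAt)
    (fun t ht => hle t ht.1 ht.2.le) (Set.right_mem_Icc.2 hT)
  simpa [Finset.sum_range_succ'] using h0

end PowerSeries

section AbstractNet

theorem seminorm_sum_le {ι E : Type*} [AddCommGroup E] [Module ℂ E] (p : Seminorm ℂ E)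
    (s : Finset ι) (f : ι → E) : p (∑ i ∈ s, f i) ≤ ∑ i ∈ s, p (f i) :=
  Finset.le_sum_of_subadditive p (map_zero p).le (map_add_le_add p) s f

variable {L : Type*} {𝔄 : Type*} [NormedRing 𝔄] [NormedAlgebra ℂ 𝔄]

/-- The commutator `a ↦ H a - a H`, as a bounded operator. -/
def adCLM (H : 𝔄) : 𝔄 →L[ℂ] 𝔄 :=
  ContinuousLinearMap.mul ℂ 𝔄 H - (ContinuousLinearMap.mul ℂ 𝔄).flip H

theorem adCLM_apply (H a : 𝔄) : adCLM H a = H * a - a * H := rfl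

theorem seminorm_adCLM_le (p : Seminorm ℂ 𝔄) {H : 𝔄} {c : ℝ} (hl : ∀ b, p (H * b) ≤ c * p b)
    (hr : ∀ b, p (b * H) ≤ c * p b) (b : 𝔄) : p (adCLM H b) ≤ 2 * c * p b :=
  calc p (H * b - b * H) ≤ p (H * b) + p (b * H) := map_sub_le_add p _ _
    _ ≤ c * p b + c * p b := add_le_add (hl b) (hr b)
    _ = 2 * c * p b := by ring

/-- An interaction in an abstract net of local algebras: `loc X` is the algebra of observables
local in `X`, and `h X` is the interaction term of `X`. -/
structure IsLocalInteraction (loc : Finset L → Subalgebra ℂ 𝔄) (h : Finset L → 𝔄) : Prop where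
  mono : ∀ {X Y}, X ⊆ Y → loc X ≤ loc Y
  commute : ∀ {X Y}, Disjoint X Y → ∀ a ∈ loc X, ∀ b ∈ loc Y, Commute a b
  mem : ∀ X, h X ∈ loc X

/-- The bound `sup_x ∑_{X ∋ x} c X * r ^ |X| ≤ κ` on nonnegative weights `c`, stated with finite
partial sums so that it contains the summability. -/
structure WeightBound (c : Finset L → ℝ) (r κ : ℝ) : Prop where
  nonneg : ∀ X, 0 ≤ c X
  sum_le : ∀ x : L, ∀ S : Finset (Finset L), (∀ X ∈ S, x ∈ X) → ∑ X ∈ S, c X * r ^ X.card ≤ κ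

/-- The Hamiltonian `∑_{X ⊆ Λ} h X` of a family of interaction terms. -/
def boxSum (h : Finset L → 𝔄) (Λ : Finset L) : 𝔄 := ∑ X ∈ Λ.powerset, h X

variable {loc : Finset L → Subalgebra ℂ 𝔄} {h : Finset L → 𝔄} {c : Finset L → ℝ} {r κ : ℝ}

namespace WeightBound

theorem mono {c' : Finset L → ℝ} (hκ : WeightBound c r κ) (hr : 0 ≤ r) (hc' : ∀ X, 0 ≤ c' X)
    (hcc' : ∀ X, c' X ≤ c X) : WeightBound c' r κ where
  nonneg := hc'
  sum_le x S hS := (Finset.sum_le_sum fun X _ => by gcongr; exact hcc' X).trans (hκ.sum_le x S hS)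

theorem sum_le_card_mul (hκ : WeightBound c r κ) {u : ℝ} (hu : 0 ≤ u) (hur : u ≤ r) {Y : Finset L}
    {S : Finset (Finset L)} (hS : ∀ X ∈ S, ¬ Disjoint X Y) :
    ∑ X ∈ S, c X * u ^ X.card ≤ Y.card * κ := by
  classical
  have hnonneg : ∀ X, 0 ≤ c X * u ^ X.card := fun X => mul_nonneg (hκ.nonneg X) (pow_nonneg hu _)
  calc ∑ X ∈ S, c X * u ^ X.card
      ≤ ∑ X ∈ S, ∑ x ∈ Y with x ∈ X, c X * u ^ X.card := by
        refine Finset.sum_le_sum fun X hX => ?_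
        obtain ⟨x, hxX, hxY⟩ := Finset.not_disjoint_iff.1 (hS X hX)
        exact Finset.single_le_sum (f := fun _ => c X * u ^ X.card) (fun _ _ => hnonneg X)
          (Finset.mem_filter.2 ⟨hxY, hxX⟩)
    _ = ∑ x ∈ Y, ∑ X ∈ S with x ∈ X, c X * u ^ X.card := by
        simp only [Finset.sum_filter]
        exact Finset.sum_comm
    _ ≤ ∑ _x ∈ Y, κ := by
        refine Finset.sum_le_sum fun x _ => le_trans (Finset.sum_le_sum fun X _ => ?_)
          (hκ.sum_le x (S.filter (x ∈ ·)) fun X hX => (Finset.mem_filter.1 hX).2)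
        have := hκ.nonneg X
        gcongr
    _ = Y.card * κ := by simp

end WeightBound

open Classical in
theorem adCLM_boxSum_apply (hloc : IsLocalInteraction loc h) (Λ : Finset L) {Y : Finset L} {a : 𝔄}
    (ha : a ∈ loc Y) :
    adCLM (boxSum h Λ) a = ∑ X ∈ Λ.powerset with ¬ Disjoint X Y, adCLM (h X) a := by
  rw [Finset.sum_filter_of_ne]
  · simp only [adCLM_apply, boxSum, Finset.sum_mul, Finset.mul_sum, Finset.sum_sub_distrib]
  · exact fun X _ hX hd => hX (sub_eq_zero.2 (hloc.commute hd _ (hloc.mem X) _ ha).eq)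

theorem IsLocalInteraction.adCLM_mem (hloc : IsLocalInteraction loc h) {X Y Z : Finset L} {a : 𝔄}
    (ha : a ∈ loc Y) (hXZ : X ⊆ Z) (hYZ : Y ⊆ Z) : adCLM (h X) a ∈ loc Z := by
  have hXmem := hloc.mono hXZ (hloc.mem X)
  have haZ := hloc.mono hYZ ha
  exact sub_mem (mul_mem hXmem haZ) (mul_mem haZ hXmem)

theorem card_union_le_of_not_disjoint [DecidableEq L] {X Y : Finset L} (hXY : ¬ Disjoint X Y) :
    (Y ∪ X).card ≤ (Y.card - 1) + X.card := by
  have hunion := Finset.card_union_add_card_inter Y X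
  have hinter : 0 < (Y ∩ X).card := by
    rwa [Finset.card_pos, Finset.inter_comm, ← Finset.not_disjoint_iff_nonempty_inter]
  have := Finset.card_le_card (Finset.inter_subset_left (s₁ := Y) (s₂ := X))
  omega

variable {p : Seminorm ℂ 𝔄}

theorem sum_adCLM_pow_succ_le (hloc : IsLocalInteraction loc h)
    (hp : ∀ X b, p (adCLM (h X) b) ≤ c X * p b) (hκ : WeightBound c r κ) {Λ : Finset L} {M : ℕ}
    {t u : ℝ} (ht : 0 ≤ t) (hu : 1 ≤ u) (hur : u ≤ r)
    (hM : ∀ Y, ∀ a ∈ loc Y, ∑ n ∈ Finset.range M, t ^ n / n.factorial *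
      p ((adCLM (boxSum h Λ) ^ n) a) ≤ u ^ Y.card * p a) {Y : Finset L} {a : 𝔄} (ha : a ∈ loc Y) :
    ∑ n ∈ Finset.range M, t ^ n / n.factorial * p ((adCLM (boxSum h Λ) ^ (n + 1)) a) ≤
      Y.card * u ^ (Y.card - 1) * κ * p a := by
  classical
  have := apply_nonneg p a
  set δ := adCLM (boxSum h Λ) with hδ
  set S := Λ.powerset.filter fun X => ¬ Disjoint X Y
  have hmeet : ∀ X ∈ S, ¬ Disjoint X Y := fun X hX => (Finset.mem_filter.1 hX).2
  have hterm : ∀ X ∈ S, ∑ n ∈ Finset.range M, t ^ n / n.factorial * p ((δ ^ n) (adCLM (h X) a)) ≤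
      u ^ (Y.card - 1) * p a * (c X * u ^ X.card) := fun X hX =>
    calc _ ≤ u ^ (Y ∪ X).card * p (adCLM (h X) a) :=
          hM _ _ (hloc.adCLM_mem ha Finset.subset_union_right Finset.subset_union_left)
      _ ≤ u ^ ((Y.card - 1) + X.card) * (c X * p a) := by
          gcongr
          exacts [card_union_le_of_not_disjoint (hmeet X hX), hp X a]
      _ = _ := by rw [pow_add]; ring
  calc ∑ n ∈ Finset.range M, t ^ n / n.factorial * p ((δ ^ (n + 1)) a)
      ≤ ∑ n ∈ Finset.range M, t ^ n / n.factorial * ∑ X ∈ S, p ((δ ^ n) (adCLM (h X) a)) := by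
        gcongr with n
        rw [pow_succ, mul_apply_eq_comp, hδ, adCLM_boxSum_apply hloc Λ ha, map_sum]
        exact seminorm_sum_le p _ _
    _ = ∑ X ∈ S, ∑ n ∈ Finset.range M, t ^ n / n.factorial * p ((δ ^ n) (adCLM (h X) a)) := by
        simp only [Finset.mul_sum]
        exact Finset.sum_comm
    _ ≤ u ^ (Y.card - 1) * p a * ∑ X ∈ S, c X * u ^ X.card := by
        rw [Finset.mul_sum]
        exact Finset.sum_le_sum hterm
    _ ≤ u ^ (Y.card - 1) * p a * (Y.card * κ) := by
        gcongr
        exact hκ.sum_le_card_mul (by linarith) hur hmeet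
    _ = _ := by ring

-- `(1 + κ t) ^ |Y|` solves the differential equation that majorizes the recurrence above.
theorem sum_adCLM_pow_le (hloc : IsLocalInteraction loc h)
    (hp : ∀ X b, p (adCLM (h X) b) ≤ c X * p b) (hκ : WeightBound c r κ) (hκ0 : 0 ≤ κ)
    (Λ : Finset L) (M : ℕ) {Y : Finset L} {a : 𝔄} (ha : a ∈ loc Y) {T : ℝ} (hT : 0 ≤ T)
    (hTr : 1 + κ * T ≤ r) :
    ∑ n ∈ Finset.range M, T ^ n / n.factorial * p ((adCLM (boxSum h Λ) ^ n) a) ≤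
      (1 + κ * T) ^ Y.card * p a := by
  induction M generalizing Y a T with
  | zero =>
    have := apply_nonneg p a
    simp only [Finset.range_zero, Finset.sum_empty]
    positivity
  | succ M ih =>
    refine sum_pow_div_factorial_le_of_deriv_le (g := fun t => (1 + κ * t) ^ Y.card * p a)
      (g' := fun t => Y.card * (1 + κ * t) ^ (Y.card - 1) * κ * p a) hT (fun t => ?_) (by simp)
      fun t ht htT => ?_
    · simpa using ((((hasDerivAt_id t).const_mul κ).const_add 1).pow Y.card).mul_const (p a)
    · have htr : 1 + κ * t ≤ r := le_trans (by gcongr) hTr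
      exact sum_adCLM_pow_succ_le hloc hp hκ ht (by nlinarith [mul_nonneg hκ0 ht]) htr
        (fun Y a ha => ih ha ht htr) ha

end AbstractNet

section Evolution

section Exponential

section Operator

variable {E : Type*} [NormedAddCommGroup E] [NormedSpace ℂ E] [CompleteSpace E]

theorem exp_add_smul_apply (T : E →L[ℂ] E) (z w : ℂ) (a : E) :
    NormedSpace.exp ((z + w) • T) a = NormedSpace.exp (z • T) (NormedSpace.exp (w • T) a) := by
  let _ : NormedAlgebra ℚ (E →L[ℂ] E) := NormedAlgebra.restrictScalars ℚ ℂ _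
  rw [add_smul, NormedSpace.exp_add_of_commute (((Commute.refl T).smul_left z).smul_right w)]
  rfl

theorem hasSum_exp_smul_apply (T : E →L[ℂ] E) (z : ℂ) (a : E) :
    HasSum (fun n : ℕ => (z ^ n / n.factorial) • (T ^ n) a) (NormedSpace.exp (z • T) a) := by
  refine ((NormedSpace.exp_series_hasSum_exp' (𝕂 := ℂ) (z • T)).mapL
    (ContinuousLinearMap.apply ℂ E a)).congr_fun fun n => ?_
  rw [smul_pow, smul_smul, div_eq_inv_mul]
  rfl

end Operator

variable {𝔄 : Type*} [NormedRing 𝔄] [NormedAlgebra ℂ 𝔄] [CompleteSpace 𝔄]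

theorem exp_mul_left (a : 𝔄) :
    NormedSpace.exp (ContinuousLinearMap.mul ℂ 𝔄 a) =
      ContinuousLinearMap.mul ℂ 𝔄 (NormedSpace.exp a) := by
  let _ : NormedAlgebra ℚ 𝔄 := NormedAlgebra.restrictScalars ℚ ℂ _
  let l : 𝔄 →+* (𝔄 →L[ℂ] 𝔄) :=
    { NonUnitalAlgHom.Lmul ℂ 𝔄 with map_one' := ContinuousLinearMap.ext one_mul }
  exact (NormedSpace.map_exp l (ContinuousLinearMap.mul ℂ 𝔄).continuous a).symm

theorem exp_mul_right (a : 𝔄) :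
    NormedSpace.exp ((ContinuousLinearMap.mul ℂ 𝔄).flip a) =
      (ContinuousLinearMap.mul ℂ 𝔄).flip (NormedSpace.exp a) := by
  let _ : NormedAlgebra ℚ 𝔄 := NormedAlgebra.restrictScalars ℚ ℂ _
  let r : 𝔄ᵐᵒᵖ →+* (𝔄 →L[ℂ] 𝔄) :=
    { toFun b := (ContinuousLinearMap.mul ℂ 𝔄).flip b.unop
      map_one' := ContinuousLinearMap.ext mul_one
      map_mul' _ _ := ContinuousLinearMap.ext fun _ => (mul_assoc _ _ _).symm
      map_zero' := map_zero _
      map_add' _ _ := map_add _ _ _ }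
  have hr : Continuous r :=
    (ContinuousLinearMap.mul ℂ 𝔄).flip.continuous.comp MulOpposite.continuous_unop
  simpa [r, NormedSpace.exp_op] using (NormedSpace.map_exp r hr (MulOpposite.op a)).symm

theorem exp_adCLM_apply (H a : 𝔄) :
    NormedSpace.exp (adCLM H) a = NormedSpace.exp H * a * NormedSpace.exp (-H) := by
  let _ : NormedAlgebra ℚ (𝔄 →L[ℂ] 𝔄) := NormedAlgebra.restrictScalars ℚ ℂ _
  have hcomm : Commute (ContinuousLinearMap.mul ℂ 𝔄 H) ((ContinuousLinearMap.mul ℂ 𝔄).flip (-H)) :=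
    ContinuousLinearMap.ext fun b => (mul_assoc H b (-H)).symm
  rw [adCLM, sub_eq_add_neg, ← map_neg, NormedSpace.exp_add_of_commute hcomm, exp_mul_left,
    exp_mul_right, mul_assoc]
  rfl

/-- The evolution `e^{izH} a e^{-izH}` at complex time `z`, as a bounded operator; the conjugation
formula is `evolution_apply`. -/
def evolution (H : 𝔄) (z : ℂ) : 𝔄 →L[ℂ] 𝔄 := NormedSpace.exp ((Complex.I * z) • adCLM H)

theorem evolution_apply (H : 𝔄) (z : ℂ) (a : 𝔄) :
    evolution H z a =
      NormedSpace.exp ((Complex.I * z) • H) * a * NormedSpace.exp (-((Complex.I * z) • H)) := by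
  rw [evolution, ← exp_adCLM_apply, adCLM, adCLM, map_smul, map_smul, smul_sub]

theorem evolution_zero (H a : 𝔄) : evolution H 0 a = a := by
  simp [evolution_apply]

theorem evolution_add (H : 𝔄) (z w : ℂ) (a : 𝔄) :
    evolution H (z + w) a = evolution H z (evolution H w a) := by
  rw [evolution, mul_add, exp_add_smul_apply]
  rfl

theorem hasSum_evolution (H : 𝔄) (z : ℂ) (a : 𝔄) :
    HasSum (fun n : ℕ => ((Complex.I * z) ^ n / n.factorial) • (adCLM H ^ n) a)
      (evolution H z a) :=
  hasSum_exp_smul_apply _ _ _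

end Exponential

variable {𝔄 : Type*} [CStarAlgebra 𝔄] {H : 𝔄}

/-- The evolution generated by a self-adjoint `H` at a real time, as a `⋆`-automorphism. -/
def realEvolution (hH : IsSelfAdjoint H) (t : ℝ) : 𝔄 ≃⋆ₐ[ℂ] 𝔄 :=
  Unitary.conjStarAlgAut ℂ 𝔄 (selfAdjoint.expUnitary (t • ⟨H, hH⟩))

theorem realEvolution_apply (hH : IsSelfAdjoint H) (t : ℝ) (a : 𝔄) :
    realEvolution hH t a = evolution H t a := by
  have hexp : (selfAdjoint.expUnitary (t • ⟨H, hH⟩ : selfAdjoint 𝔄) : 𝔄) =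
      NormedSpace.exp ((Complex.I * t) • H) := by
    rw [selfAdjoint.expUnitary_coe, mul_smul, selfAdjoint.val_smul, Complex.coe_smul]
  have hstar : star ((Complex.I * t) • H) = -((Complex.I * t) • H) := by
    rw [star_smul, hH.star_eq, ← neg_smul]
    simp
  rw [realEvolution, Unitary.conjStarAlgAut_apply, hexp, NormedSpace.star_exp, hstar,
    evolution_apply]

theorem norm_evolution (hH : IsSelfAdjoint H) (t : ℝ) (a : 𝔄) : ‖evolution H t a‖ = ‖a‖ := by
  rw [← realEvolution_apply hH, StarAlgEquiv.norm_map]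

end Evolution

section ExponentialSeriesLimit

variable {E : Type*} [NormedAddCommGroup E] [NormedSpace ℂ E] {ι : Type*} {F : Filter ι}
  {R C : ℝ}

theorem norm_pow_div_factorial_smul_le {n : ℕ} {z : ℂ} {b : E} {ρ : ℝ} (hz : ‖z‖ ≤ ρ)
    (hb : ‖b‖ ≤ n.factorial / R ^ n * C) :
    ‖(z ^ n / n.factorial) • b‖ ≤ (ρ / R) ^ n * C := by
  have hρ : 0 ≤ ρ := (norm_nonneg z).trans hz
  rw [norm_smul, norm_div, norm_pow, Complex.norm_natCast]
  calc ‖z‖ ^ n / n.factorial * ‖b‖ ≤ ρ ^ n / n.factorial * (n.factorial / R ^ n * C) := by gcongr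
    _ = (ρ / R) ^ n * C := by
        rw [← mul_assoc, div_mul_div_cancel₀ (by positivity), div_pow]

theorem summable_div_pow_mul {ρ : ℝ} (hρ : 0 ≤ ρ) (hρR : ρ < R) :
    Summable fun n : ℕ => (ρ / R) ^ n * C :=
  (summable_geometric_of_lt_one (div_nonneg hρ (hρ.trans hρR.le))
    ((div_lt_one (hρ.trans_lt hρR)).2 hρR)).mul_right C

theorem differentiableOn_tsum_pow_div_factorial [CompleteSpace E] {b : ℕ → E}
    (hb : ∀ n, ‖b n‖ ≤ n.factorial / R ^ n * C) :
    DifferentiableOn ℂ (fun z : ℂ => ∑' n : ℕ, (z ^ n / n.factorial) • b n)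
      (Metric.ball 0 R) := fun z hz => by
  obtain ⟨ρ, hzρ, hρR⟩ := exists_between (mem_ball_zero_iff.1 hz)
  have hdiff := Complex.differentiableOn_tsum_of_summable_norm
    (summable_div_pow_mul (C := C) ((norm_nonneg z).trans hzρ.le) hρR)
    (F := fun (n : ℕ) (z : ℂ) => (z ^ n / n.factorial) • b n) (U := Metric.ball 0 ρ)
    (fun n => by fun_prop) Metric.isOpen_ball
    (fun n w hw => norm_pow_div_factorial_smul_le (mem_ball_zero_iff.1 hw).le (hb n))
  exact (hdiff.differentiableAt (Metric.isOpen_ball.mem_nhds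
    (mem_ball_zero_iff.2 hzρ))).differentiableWithinAt

theorem tendsto_tsum_pow_div_factorial [CompleteSpace E] {b : ι → ℕ → E} {l : ℕ → E}
    (hb : ∀ i n, ‖b i n‖ ≤ n.factorial / R ^ n * C)
    (hl : ∀ n, Tendsto (fun i => b i n) F (𝓝 (l n))) {z : ℂ} (hz : ‖z‖ < R) :
    Tendsto (fun i => ∑' n : ℕ, (z ^ n / n.factorial) • b i n) F
      (𝓝 (∑' n : ℕ, (z ^ n / n.factorial) • l n)) :=
  tendsto_tsum_of_dominated_convergence (summable_div_pow_mul (C := C) (norm_nonneg z) hz)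
    (fun n => (hl n).const_smul _)
    (Eventually.of_forall fun i n => norm_pow_div_factorial_smul_le le_rfl (hb i n))

end ExponentialSeriesLimit

section Limit

variable {L : Type*} {𝔄 : Type*} [NormedRing 𝔄] [NormedAlgebra ℂ 𝔄]
  {loc : Finset L → Subalgebra ℂ 𝔄} {h : Finset L → 𝔄} {c : Finset L → ℝ} {r κ : ℝ}

theorem norm_adCLM_pow_le (hloc : IsLocalInteraction loc h)
    (hc : ∀ X b, ‖adCLM (h X) b‖ ≤ c X * ‖b‖) (hκ : WeightBound c r κ) (hκ0 : 0 < κ) (hr : 1 < r)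
    (Λ : Finset L) (n : ℕ) {Y : Finset L} {a : 𝔄} (ha : a ∈ loc Y) :
    ‖(adCLM (boxSum h Λ) ^ n) a‖ ≤ n.factorial / ((r - 1) / κ) ^ n * (r ^ Y.card * ‖a‖) := by
  have hR : 0 < (r - 1) / κ := div_pos (by linarith) hκ0
  have hRr : 1 + κ * ((r - 1) / κ) = r := by field_simp; ring
  have hsum := sum_adCLM_pow_le (p := normSeminorm ℂ 𝔄) hloc hc hκ hκ0.le Λ (n + 1) ha hR.le hRr.le
  simp only [coe_normSeminorm, hRr] at hsum
  have hterm := (Finset.single_le_sum (f := fun m : ℕ => ((r - 1) / κ) ^ m / m.factorial *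
    ‖(adCLM (boxSum h Λ) ^ m) a‖) (fun m _ => by positivity) (Finset.self_mem_range_succ n)).trans
    hsum
  rw [div_mul_eq_mul_div, div_le_iff₀ (by positivity)] at hterm
  rw [div_mul_eq_mul_div, le_div_iff₀ (by positivity)]
  linarith

theorem WeightBound.summable (hκ : WeightBound c r κ) (hr : 0 ≤ r) (Y : Finset L) :
    Summable fun X : {X : Finset L // ¬ Disjoint X Y} => c X * r ^ X.1.card := by
  refine summable_of_sum_le (c := Y.card * κ)
    (fun X => mul_nonneg (hκ.nonneg _) (pow_nonneg hr _)) fun S => ?_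
  have hle := hκ.sum_le_card_mul hr le_rfl (Y := Y) (S := S.map (.subtype _))
    (by simp +contextual)
  rwa [Finset.sum_map] at hle

open Classical in
theorem adCLM_boxSum_pow_succ_apply (hloc : IsLocalInteraction loc h) (Λ : Finset L) (n : ℕ)
    {Y : Finset L} {a : 𝔄} (ha : a ∈ loc Y) :
    (adCLM (boxSum h Λ) ^ (n + 1)) a = ∑' X : {X : Finset L // ¬ Disjoint X Y},
      ({X | X.1 ⊆ Λ} : Set {X : Finset L // ¬ Disjoint X Y}).indicator
        (fun X => (adCLM (boxSum h Λ) ^ n) (adCLM (h X) a)) X := by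
  have hcoe : ({X | X.1 ⊆ Λ} : Set {X : Finset L // ¬ Disjoint X Y}) =
      Λ.powerset.subtype fun X => ¬ Disjoint X Y := by
    ext X
    simp
  rw [pow_succ, mul_apply_eq_comp, adCLM_boxSum_apply hloc Λ ha, map_sum, hcoe,
    ← sum_eq_tsum_indicator,
    Finset.sum_subtype_eq_sum_filter (fun X => (adCLM (boxSum h Λ) ^ n) (adCLM (h X) a))]

theorem exists_tendsto_adCLM_pow [CompleteSpace 𝔄] (hloc : IsLocalInteraction loc h)
    (hc : ∀ X b, ‖adCLM (h X) b‖ ≤ c X * ‖b‖) (hκ : WeightBound c r κ) (hκ0 : 0 < κ) (hr : 1 < r)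
    (n : ℕ) {Y : Finset L} {a : 𝔄} (ha : a ∈ loc Y) :
    ∃ l, Tendsto (fun Λ => (adCLM (boxSum h Λ) ^ n) a) atTop (𝓝 l) := by
  classical
  induction n generalizing Y a with
  | zero => exact ⟨a, by simp⟩
  | succ n ih =>
    have : 0 < (r - 1) / κ := div_pos (by linarith) hκ0
    have hmem : ∀ X, adCLM (h X) a ∈ loc (Y ∪ X) := fun X =>
      hloc.adCLM_mem ha Finset.subset_union_right Finset.subset_union_left
    choose l hl using fun X => ih (hmem X)
    have hbound : ∀ Λ X, ‖(adCLM (boxSum h Λ) ^ n) (adCLM (h X) a)‖ ≤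
        n.factorial / ((r - 1) / κ) ^ n * (r ^ Y.card * ‖a‖) * (c X * r ^ X.card) := fun Λ X =>
      calc _ ≤ n.factorial / ((r - 1) / κ) ^ n * (r ^ (Y ∪ X).card * ‖adCLM (h X) a‖) :=
            norm_adCLM_pow_le hloc hc hκ hκ0 hr Λ n (hmem X)
        _ ≤ n.factorial / ((r - 1) / κ) ^ n * (r ^ (Y.card + X.card) * (c X * ‖a‖)) := by
            gcongr
            exacts [hr.le, Finset.card_union_le _ _, hc X a]
        _ = _ := by rw [pow_add]; ring
    refine ⟨∑' X : {X : Finset L // ¬ Disjoint X Y}, l X, ?_⟩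
    simp only [adCLM_boxSum_pow_succ_apply hloc _ n ha]
    refine tendsto_tsum_of_dominated_convergence ((hκ.summable (by linarith) Y).mul_left _)
      (fun X => (hl X).congr' ?_)
      (Eventually.of_forall fun Λ X => (norm_indicator_le_norm_self _ _).trans (hbound Λ X))
    filter_upwards [eventually_ge_atTop X.1] with Λ hΛ
    exact (Set.indicator_of_mem (s := {X : {X : Finset L // ¬ Disjoint X Y} | X.1 ⊆ Λ}) hΛ
      fun X => (adCLM (boxSum h Λ) ^ n) (adCLM (h X) a)).symm

theorem exists_tendsto_evolution_ball [CompleteSpace 𝔄] (hloc : IsLocalInteraction loc h)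
    (hc : ∀ X b, ‖adCLM (h X) b‖ ≤ c X * ‖b‖) (hκ : WeightBound c r κ) (hκ0 : 0 < κ) (hr : 1 < r)
    {Y : Finset L} {a : 𝔄} (ha : a ∈ loc Y) :
    ∃ g : ℂ → 𝔄, DifferentiableOn ℂ g (Metric.ball 0 ((r - 1) / κ)) ∧
      ∀ z ∈ Metric.ball (0 : ℂ) ((r - 1) / κ),
        Tendsto (fun Λ => evolution (boxSum h Λ) z a) atTop (𝓝 (g z)) := by
  choose l hl using fun n => exists_tendsto_adCLM_pow hloc hc hκ hκ0 hr n ha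
  have hbound := fun Λ n => norm_adCLM_pow_le hloc hc hκ hκ0 hr Λ n ha
  have hlbound := fun n => le_of_tendsto (hl n).norm (Eventually.of_forall (hbound · n))
  have hI : ∀ z ∈ Metric.ball (0 : ℂ) ((r - 1) / κ),
      Complex.I * z ∈ Metric.ball (0 : ℂ) ((r - 1) / κ) := by simp
  refine ⟨fun z => ∑' n : ℕ, ((Complex.I * z) ^ n / n.factorial) • l n,
    (differentiableOn_tsum_pow_div_factorial hlbound).comp (by fun_prop) hI, fun z hz => ?_⟩
  simp only [← (hasSum_evolution _ z a).tsum_eq]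
  exact tendsto_tsum_pow_div_factorial hbound hl (mem_ball_zero_iff.1 (hI z hz))

theorem seminorm_evolution_sub_le [CompleteSpace 𝔄] (hloc : IsLocalInteraction loc h)
    {p : Seminorm ℂ 𝔄} (hpcont : Continuous p) (hp : ∀ X b, p (adCLM (h X) b) ≤ c X * p b)
    (hκ : WeightBound c r κ) (hκ0 : 0 ≤ κ) (Λ : Finset L) {Y : Finset L} {a : 𝔄} (ha : a ∈ loc Y)
    {z : ℂ} (hz : 1 + κ * ‖z‖ ≤ r) :
    p (evolution (boxSum h Λ) z a - a) ≤ ((1 + κ * ‖z‖) ^ Y.card - 1) * p a := by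
  have htail := (hasSum_nat_add_iff' 1).2 (hasSum_evolution (boxSum h Λ) z a)
  simp only [Finset.sum_range_one, pow_zero, Nat.factorial_zero, Nat.cast_one, div_one, one_smul,
    one_apply_eq_self] at htail
  refine le_of_tendsto ((hpcont.tendsto _).comp htail.tendsto_sum_nat)
    (Eventually.of_forall fun M => ?_)
  have hsum := sum_adCLM_pow_le hloc hp hκ hκ0 Λ (M + 1) ha (norm_nonneg z) hz
  rw [Finset.sum_range_succ', pow_zero, pow_zero, one_apply_eq_self, Nat.factorial_zero,
    Nat.cast_one, div_one, one_mul] at hsum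
  calc p (∑ n ∈ Finset.range M, ((Complex.I * z) ^ (n + 1) / (n + 1).factorial) •
        (adCLM (boxSum h Λ) ^ (n + 1)) a)
      ≤ ∑ n ∈ Finset.range M, p (((Complex.I * z) ^ (n + 1) / (n + 1).factorial) •
        (adCLM (boxSum h Λ) ^ (n + 1)) a) :=
        seminorm_sum_le p _ _
    _ = ∑ n ∈ Finset.range M, ‖z‖ ^ (n + 1) / (n + 1).factorial *
        p ((adCLM (boxSum h Λ) ^ (n + 1)) a) := by
        simp only [map_smul_eq_mul, norm_div, norm_pow, norm_mul, Complex.norm_I, one_mul,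
          Complex.norm_natCast]
    _ ≤ ((1 + κ * ‖z‖) ^ Y.card - 1) * p a := by linarith

end Limit

section LimitDynamics

section Equicontinuous

variable {ι X Y : Type*}

theorem tendsto_apply_of_equicontinuousAt [TopologicalSpace X] [UniformSpace Y] {F : Filter ι}
    {T : ι → X → Y} {x : ι → X} {x₀ : X} {y : Y} (hT : EquicontinuousAt T x₀)
    (hx : Tendsto x F (𝓝 x₀)) (hy : Tendsto (fun i => T i x₀) F (𝓝 y)) :
    Tendsto (fun i => T i (x i)) F (𝓝 y) :=
  hy.congr_uniformity fun V hV => (hx.eventually (hT V hV)).mono fun i hi => hi i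

theorem exists_tendsto_of_dense [PseudoMetricSpace X] [PseudoMetricSpace Y] [CompleteSpace Y]
    {F : Filter ι} [F.NeBot] {T : ι → X → Y} (hT : Equicontinuous T) {S : Set X} (hS : Dense S)
    (hlim : ∀ x ∈ S, ∃ y, Tendsto (fun i => T i x) F (𝓝 y)) (x : X) :
    ∃ y, Tendsto (fun i => T i x) F (𝓝 y) := by
  refine cauchy_map_iff_exists_tendsto.1 (Metric.cauchy_iff.2 ⟨inferInstance, fun ε hε => ?_⟩)
  obtain ⟨δ, hδ, hxδ⟩ := Metric.equicontinuousAt_iff.1 (hT x) (ε / 3) (by positivity)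
  obtain ⟨x', hx', hx'S⟩ := Metric.dense_iff.1 hS x δ hδ
  obtain ⟨y, hy⟩ := hlim x' hx'S
  have hclose : ∀ᶠ i in F, dist (T i x) y < ε / 2 := by
    filter_upwards [Metric.tendsto_nhds.1 hy (ε / 6) (by positivity)] with i hi
    linarith [dist_triangle (T i x) (T i x') y, hxδ x' hx' i]
  refine ⟨_, image_mem_map hclose, ?_⟩
  rintro _ ⟨i, hi, rfl⟩ _ ⟨j, hj, rfl⟩
  rw [Set.mem_ofPred_eq] at hi hj
  linarith [dist_triangle_right (T i x) (T j x) y]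

end Equicontinuous

variable {𝔄 : Type*} [CStarAlgebra 𝔄] {ι : Type*} {F : Filter ι} {H : ι → 𝔄}

theorem equicontinuous_evolution (hH : ∀ i, IsSelfAdjoint (H i)) (t : ℝ) :
    Equicontinuous fun i => ⇑(evolution (H i) t) :=
  (LipschitzWith.uniformEquicontinuous _ 1 fun i =>
    (AddMonoidHomClass.isometry_of_norm _ (norm_evolution (hH i) t)).lipschitz).equicontinuous

-- Long times are reached by iterating a short one, by the group property.
theorem exists_tendsto_evolution_of_small (hH : ∀ i, IsSelfAdjoint (H i)) {R : ℝ} (hR : 0 < R)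
    (hsmall : ∀ t : ℝ, |t| < R → ∀ a, ∃ l, Tendsto (fun i => evolution (H i) t a) F (𝓝 l))
    (t : ℝ) (a : 𝔄) : ∃ l, Tendsto (fun i => evolution (H i) t a) F (𝓝 l) := by
  obtain ⟨m, hm⟩ := exists_nat_gt (|t| / R)
  have hm0 : 0 < (m : ℝ) := lt_of_le_of_lt (by positivity) hm
  have hstep : |t / m| < R := by rwa [abs_div, abs_of_pos hm0, div_lt_comm₀ hm0 hR]
  have hmul : ∀ k : ℕ, ∃ l, Tendsto (fun i => evolution (H i) ((k * (t / m) : ℝ)) a) F (𝓝 l) := by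
    intro k
    induction k with
    | zero => exact ⟨a, by simpa [evolution_zero] using tendsto_const_nhds⟩
    | succ k ih =>
      obtain ⟨b, hb⟩ := ih
      obtain ⟨l, hl⟩ := hsmall _ hstep b
      refine ⟨l, (tendsto_apply_of_equicontinuousAt (equicontinuous_evolution hH (t / m : ℝ) b)
        hb hl).congr fun i => ?_⟩
      rw [← evolution_add]
      congr 2
      push_cast
      ring
  simpa [mul_div_cancel₀ t hm0.ne'] using hmul m

/-- The evolutions generated by the self-adjoint elements `H i` converge strongly along `F` at all
real times. -/
structure HasLimitDynamics (F : Filter ι) (H : ι → 𝔄) : Prop where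
  isSelfAdjoint : ∀ i, IsSelfAdjoint (H i)
  exists_tendsto : ∀ (t : ℝ) (a : 𝔄), ∃ l, Tendsto (fun i => evolution (H i) t a) F (𝓝 l)

/-- The limit along `F` of the evolutions generated by `H i`; it is meaningful only under
`HasLimitDynamics F H`. -/
def limitEvolution (F : Filter ι) (H : ι → 𝔄) (t : ℝ) (a : 𝔄) : 𝔄 :=
  limUnder F fun i => evolution (H i) t a

namespace HasLimitDynamics

theorem tendsto (hl : HasLimitDynamics F H) (t : ℝ) (a : 𝔄) :
    Tendsto (fun i => evolution (H i) t a) F (𝓝 (limitEvolution F H t a)) :=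
  tendsto_nhds_limUnder (hl.exists_tendsto t a)

theorem tendsto_realEvolution (hl : HasLimitDynamics F H) (t : ℝ) (a : 𝔄) :
    Tendsto (fun i => realEvolution (hl.isSelfAdjoint i) t a) F (𝓝 (limitEvolution F H t a)) := by
  simpa only [realEvolution_apply] using hl.tendsto t a

theorem tendsto_of_tendsto (hl : HasLimitDynamics F H) (t : ℝ) {b : ι → 𝔄} {b₀ : 𝔄}
    (hb : Tendsto b F (𝓝 b₀)) :
    Tendsto (fun i => evolution (H i) t (b i)) F (𝓝 (limitEvolution F H t b₀)) :=
  tendsto_apply_of_equicontinuousAt (equicontinuous_evolution hl.isSelfAdjoint t b₀) hb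
    (hl.tendsto t b₀)

variable [F.NeBot]

theorem limitEvolution_zero (hl : HasLimitDynamics F H) (a : 𝔄) : limitEvolution F H 0 a = a :=
  tendsto_nhds_unique (hl.tendsto 0 a) (by simp [evolution_zero])

theorem limitEvolution_add (hl : HasLimitDynamics F H) (s t : ℝ) (a : 𝔄) :
    limitEvolution F H (s + t) a = limitEvolution F H s (limitEvolution F H t a) :=
  tendsto_nhds_unique (hl.tendsto (s + t) a) <| by
    simpa [evolution_add] using hl.tendsto_of_tendsto s (hl.tendsto t a)

theorem limitEvolution_neg_cancel (hl : HasLimitDynamics F H) (t : ℝ) (a : 𝔄) :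
    limitEvolution F H (-t) (limitEvolution F H t a) = a := by
  rw [← hl.limitEvolution_add, neg_add_cancel, hl.limitEvolution_zero]

/-- The limit evolution as a `⋆`-automorphism. -/
def automorphism (hl : HasLimitDynamics F H) (t : ℝ) : 𝔄 ≃⋆ₐ[ℂ] 𝔄 where
  toFun := limitEvolution F H t
  invFun := limitEvolution F H (-t)
  left_inv := hl.limitEvolution_neg_cancel t
  right_inv a := by simpa using hl.limitEvolution_neg_cancel (-t) a
  map_mul' a b := tendsto_nhds_unique (hl.tendsto_realEvolution t (a * b)) <| by
    simpa using (hl.tendsto_realEvolution t a).mul (hl.tendsto_realEvolution t b)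
  map_add' a b := tendsto_nhds_unique (hl.tendsto_realEvolution t (a + b)) <| by
    simpa using (hl.tendsto_realEvolution t a).add (hl.tendsto_realEvolution t b)
  map_star' a := tendsto_nhds_unique (hl.tendsto_realEvolution t (star a)) <| by
    simpa [map_star] using (hl.tendsto_realEvolution t a).star
  map_smul' c a := tendsto_nhds_unique (hl.tendsto_realEvolution t (c • a)) <| by
    simpa using (hl.tendsto_realEvolution t a).const_smul c

theorem tendsto_automorphism (hl : HasLimitDynamics F H) (t : ℝ) (a : 𝔄) :
    Tendsto (fun i => evolution (H i) t a) F (𝓝 (hl.automorphism t a)) :=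
  hl.tendsto t a

theorem exists_tendsto_strip (hl : HasLimitDynamics F H) {R : ℝ} {a : 𝔄} {g : ℂ → 𝔄}
    (hg : DifferentiableOn ℂ g (Metric.ball 0 R))
    (hga : ∀ z ∈ Metric.ball (0 : ℂ) R, Tendsto (fun i => evolution (H i) z a) F (𝓝 (g z))) :
    ∃ f : ℂ → 𝔄, DifferentiableOn ℂ f {z | |z.im| < R} ∧
      ∀ z : ℂ, |z.im| < R → Tendsto (fun i => evolution (H i) z a) F (𝓝 (f z)) := by
  have htranslate : ∀ (t : ℝ) (z : ℂ), z - t ∈ Metric.ball (0 : ℂ) R →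
      Tendsto (fun i => evolution (H i) z a) F (𝓝 (hl.automorphism t (g (z - t)))) :=
    fun t z hz => (hl.tendsto_of_tendsto t (hga _ hz)).congr fun i => by
      rw [← evolution_add, add_sub_cancel]
  have hmem : ∀ z : ℂ, |z.im| < R → z - z.re ∈ Metric.ball (0 : ℂ) R := fun z hz => by
    have him : z - z.re = z.im * Complex.I := by
      rw [sub_eq_iff_eq_add', Complex.re_add_im]
    simpa [him] using hz
  refine ⟨fun z => hl.automorphism z.re (g (z - z.re)), fun z hz => ?_,
    fun z hz => htranslate _ _ (hmem z hz)⟩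
  -- Near `z` the translation parameter can be frozen, since limits are unique.
  have hball : ∀ᶠ w : ℂ in 𝓝 z, w - z.re ∈ Metric.ball (0 : ℂ) R :=
    (continuous_id.sub continuous_const).continuousAt.eventually_mem
      (Metric.isOpen_ball.mem_nhds (hmem z hz))
  have hstrip : ∀ᶠ w : ℂ in 𝓝 z, |w.im| < R :=
    (isOpen_lt Complex.continuous_im.abs continuous_const).mem_nhds hz
  let α : 𝔄 →L[ℂ] 𝔄 := ⟨hl.automorphism z.re, map_continuous (hl.automorphism z.re)⟩
  have hfrozen : DifferentiableAt ℂ (fun w => hl.automorphism z.re (g (w - z.re))) z :=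
    α.differentiableAt.comp z
      ((hg.differentiableAt (Metric.isOpen_ball.mem_nhds (hmem z hz))).comp z
        (differentiableAt_id.sub_const _))
  refine (hfrozen.congr_of_eventuallyEq ?_).differentiableWithinAt
  filter_upwards [hball, hstrip] with w hw hw'
  exact tendsto_nhds_unique (htranslate _ _ (hmem w hw')) (htranslate _ _ hw)

end HasLimitDynamics

variable {L : Type*} {loc : Finset L → Subalgebra ℂ 𝔄} {h : Finset L → 𝔄} {c : Finset L → ℝ}
  {r κ : ℝ}

theorem IsLocalInteraction.hasLimitDynamics (hloc : IsLocalInteraction loc h)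
    (hsa : ∀ X, IsSelfAdjoint (h X)) (hdense : Dense (⋃ Y, (loc Y : Set 𝔄)))
    (hc : ∀ X b, ‖adCLM (h X) b‖ ≤ c X * ‖b‖) (hκ : WeightBound c r κ) (hκ0 : 0 < κ)
    (hr : 1 < r) : HasLimitDynamics atTop (boxSum h) := by
  classical
  have hH : ∀ Λ, IsSelfAdjoint (boxSum h Λ) := fun Λ => isSelfAdjoint_sum _ fun X _ => hsa X
  refine ⟨hH, exists_tendsto_evolution_of_small hH (div_pos (sub_pos.2 hr) hκ0) fun t ht =>
    exists_tendsto_of_dense (equicontinuous_evolution hH t) hdense fun a ha => ?_⟩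
  obtain ⟨Y, hY⟩ := Set.mem_iUnion.1 ha
  obtain ⟨g, -, hg⟩ := exists_tendsto_evolution_ball hloc hc hκ hκ0 hr hY
  exact ⟨g t, hg t (by simpa using ht)⟩

theorem IsLocalInteraction.exists_tendsto_strip (hloc : IsLocalInteraction loc h)
    (hl : HasLimitDynamics atTop (boxSum h)) (hc : ∀ X b, ‖adCLM (h X) b‖ ≤ c X * ‖b‖)
    (hκ : WeightBound c r κ) (hκ0 : 0 < κ) (hr : 1 < r) {Y : Finset L} {a : 𝔄} (ha : a ∈ loc Y) :
    ∃ f : ℂ → 𝔄, DifferentiableOn ℂ f {z | |z.im| < (r - 1) / κ} ∧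
      ∀ z : ℂ, |z.im| < (r - 1) / κ →
        Tendsto (fun Λ => evolution (boxSum h Λ) z a) atTop (𝓝 (f z)) := by
  classical
  obtain ⟨g, hg, hga⟩ := exists_tendsto_evolution_ball hloc hc hκ hκ0 hr ha
  exact hl.exists_tendsto_strip hg hga

end LimitDynamics

section FourierInversion

open scoped ComplexConjugate

variable {G : Type*} [AddCommGroup G] [Fintype G]

theorem sum_norm_sq_sum_mul_addChar (f : G → ℂ) :
    ∑ ψ : AddChar G ℂ, ‖∑ τ, f τ * ψ (-τ)‖ ^ 2 = Fintype.card G * ∑ τ, ‖f τ‖ ^ 2 := by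
  classical
  have hexpand : ∀ ψ : AddChar G ℂ, ((‖∑ τ, f τ * ψ (-τ)‖ ^ 2 : ℝ) : ℂ) =
      ∑ τ, ∑ τ', f τ * conj (f τ') * ψ (τ' - τ) := fun ψ => by
    push_cast
    rw [← Complex.mul_conj', map_sum, Finset.sum_mul_sum]
    refine Finset.sum_congr rfl fun τ _ => Finset.sum_congr rfl fun τ' _ => ?_
    rw [map_mul, ← AddChar.map_neg_eq_conj, neg_neg, sub_eq_neg_add, AddChar.map_add_eq_mul]
    ring
  have hcomplex : ((∑ ψ : AddChar G ℂ, ‖∑ τ, f τ * ψ (-τ)‖ ^ 2 : ℝ) : ℂ) =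
      ((Fintype.card G * ∑ τ, ‖f τ‖ ^ 2 : ℝ) : ℂ) := by
    rw [Complex.ofReal_sum, Finset.sum_congr rfl fun ψ _ => hexpand ψ, Finset.sum_comm]
    push_cast
    rw [Finset.mul_sum]
    refine Finset.sum_congr rfl fun τ _ => ?_
    rw [Finset.sum_comm]
    simp only [← Finset.mul_sum, AddChar.sum_apply_eq_ite, sub_eq_zero, mul_ite, mul_zero,
      Finset.sum_ite_eq', Finset.mem_univ, if_true]
    rw [Complex.mul_conj', mul_comm]
  exact_mod_cast hcomplex

/-- The coefficients of a matrix in the basis of Weyl operators. -/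
def weylCoeff (M : Matrix G G ℂ) (a : G) (ψ : AddChar G ℂ) : ℂ :=
  (Fintype.card G : ℂ)⁻¹ * ∑ τ, M (τ + a) τ * ψ (-τ)

theorem sum_weylCoeff_mul (M : Matrix G G ℂ) (a τ : G) :
    ∑ ψ, weylCoeff M a ψ * ψ τ = M (τ + a) τ := by
  classical
  have hcard : (Fintype.card G : ℂ) ≠ 0 := by simp
  simp only [weylCoeff, mul_assoc, Finset.sum_mul, ← AddChar.map_add_eq_mul, ← Finset.mul_sum]
  rw [Finset.sum_comm]
  simp only [← Finset.mul_sum, AddChar.sum_apply_eq_ite, neg_add_eq_zero, mul_ite, mul_zero,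
    Finset.sum_ite_eq', Finset.mem_univ, if_true]
  field_simp

end FourierInversion

section Weyl

variable {G : Type*} [AddCommGroup G] [DecidableEq G]

/-- The Weyl operator on `ℂ^G`: multiplication by the character `ψ`, then translation by `a`. -/
def weyl (a : G) (ψ : AddChar G ℂ) : Matrix G G ℂ :=
  Matrix.of fun σ τ => if σ = τ + a then ψ τ else 0

theorem weyl_apply (a : G) (ψ : AddChar G ℂ) (σ τ : G) :
    weyl a ψ σ τ = if σ = τ + a then ψ τ else 0 := rfl

theorem weyl_zero_one : weyl (0 : G) (1 : AddChar G ℂ) = 1 := by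
  ext σ τ
  simp [weyl_apply, Matrix.one_apply]

theorem star_weyl [Finite G] (a : G) (ψ : AddChar G ℂ) : star (weyl a ψ) = ψ a • weyl (-a) ψ⁻¹ := by
  ext σ τ
  simp only [Matrix.star_eq_conjTranspose, Matrix.conjTranspose_apply, weyl_apply,
    Matrix.smul_apply, smul_eq_mul, ← sub_eq_add_neg, eq_sub_iff_add_eq, eq_comm (a := τ)]
  split_ifs with h
  · rw [← h, AddChar.inv_apply, ← AddChar.map_add_eq_mul, neg_add_rev, add_neg_cancel_left,
      AddChar.map_neg_eq_conj]
    rfl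
  · simp

variable [Fintype G]

theorem weyl_mul (a b : G) (ψ χ : AddChar G ℂ) :
    weyl a ψ * weyl b χ = ψ b • weyl (a + b) (ψ * χ) := by
  ext σ τ
  simp only [Matrix.mul_apply, weyl_apply, mul_ite, mul_zero, Finset.sum_ite_eq',
    Finset.mem_univ, if_true, Matrix.smul_apply, smul_eq_mul, AddChar.mul_apply]
  rw [show τ + b + a = τ + (a + b) by abel]
  split_ifs
  · rw [AddChar.map_add_eq_mul]
    ring
  · simp

theorem weyl_mem_unitary (a : G) (ψ : AddChar G ℂ) : weyl a ψ ∈ unitary (Matrix G G ℂ) := by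
  have hmul : star (weyl a ψ) * weyl a ψ = 1 := by
    rw [star_weyl, smul_mul_assoc, weyl_mul, neg_add_cancel, inv_mul_cancel, weyl_zero_one,
      smul_smul, AddChar.inv_apply, ← AddChar.map_add_eq_mul, add_neg_cancel,
      AddChar.map_zero_eq_one, one_smul]
  exact ⟨hmul, mul_eq_one_comm.1 hmul⟩

theorem norm_weyl_le (a : G) (ψ : AddChar G ℂ) : ‖weyl a ψ‖ ≤ 1 :=
  CStarRing.norm_of_mem_unitary (weyl_mem_unitary a ψ) |>.le

theorem weyl_mul_comm (a b : G) (ψ χ : AddChar G ℂ) :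
    weyl b χ * weyl a ψ = (χ a * ψ (-b)) • (weyl a ψ * weyl b χ) := by
  rw [weyl_mul, weyl_mul, smul_smul, mul_assoc, ← AddChar.map_add_eq_mul, neg_add_cancel,
    AddChar.map_zero_eq_one, mul_one, add_comm, mul_comm]

theorem weyl_conj (a b : G) (ψ χ : AddChar G ℂ) :
    weyl b χ * weyl a ψ * star (weyl b χ) = (χ a * ψ (-b)) • weyl a ψ := by
  rw [weyl_mul_comm, smul_mul_assoc, mul_assoc,
    Unitary.mul_star_self_of_mem (weyl_mem_unitary b χ), mul_one]

theorem sum_weyl_conj_eq_zero {G' : Type*} [AddCommGroup G'] [Fintype G'] (i : G' →+ G)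
    (π : G →+ G') {a : G} {ψ : AddChar G ℂ} (h : π a ≠ 0 ∨ ψ.compAddMonoidHom i ≠ 1) :
    ∑ b : G', ∑ χ : AddChar G' ℂ, weyl (i b) (χ.compAddMonoidHom π) * weyl a ψ *
      star (weyl (i b) (χ.compAddMonoidHom π)) = 0 := by
  classical
  have hneg : ∑ b, ψ (-i b) = ∑ b, ψ.compAddMonoidHom i b := by
    simp only [← map_neg, ← AddChar.compAddMonoidHom_apply]
    exact Equiv.sum_comp (Equiv.neg G') _
  simp only [weyl_conj, AddChar.compAddMonoidHom_apply, ← Finset.sum_smul, ← Finset.sum_mul,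
    ← Finset.mul_sum]
  rw [hneg]
  rcases h with h | h
  · rw [AddChar.sum_apply_eq_zero_iff_ne_zero.2 h, zero_mul, zero_smul]
  · rw [AddChar.sum_eq_zero_of_ne_one h, mul_zero, zero_smul]

theorem sum_norm_sq_col_le {m n : Type*} [Fintype m] [Fintype n] [DecidableEq n]
    (M : Matrix m n ℂ) (j : n) : ∑ i, ‖M i j‖ ^ 2 ≤ ‖M‖ ^ 2 := by
  have hcol := Matrix.l2_opNorm_mulVec M (EuclideanSpace.single j 1)
  rw [PiLp.norm_single, norm_one, mul_one] at hcol
  have hsq := pow_le_pow_left₀ (norm_nonneg _) hcol 2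
  rw [EuclideanSpace.norm_sq_eq] at hsq
  simpa using hsq

theorem sum_weylCoeff_smul (M : Matrix G G ℂ) :
    ∑ a, ∑ ψ, weylCoeff M a ψ • weyl a ψ = M := by
  ext σ τ
  simp only [Matrix.sum_apply, Matrix.smul_apply, weyl_apply, smul_eq_mul, mul_ite, mul_zero,
    ← sub_eq_iff_eq_add']
  simp [Finset.sum_ite_irrel, sum_weylCoeff_mul]

theorem sum_norm_weylCoeff_le (M : Matrix G G ℂ) :
    ∑ a, ∑ ψ, ‖weylCoeff M a ψ‖ ≤ Fintype.card G * ‖M‖ := by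
  have hcard : (0 : ℝ) < Fintype.card G := by exact_mod_cast Fintype.card_pos
  have hparseval : ∀ a, ∑ ψ, ‖weylCoeff M a ψ‖ ^ 2 =
      (Fintype.card G : ℝ)⁻¹ * ∑ τ, ‖M (τ + a) τ‖ ^ 2 := fun a => by
    simp only [weylCoeff, norm_mul, mul_pow, ← Finset.mul_sum, norm_inv, Complex.norm_natCast]
    rw [sum_norm_sq_sum_mul_addChar]
    field_simp
  have hsq : ∑ x : G × AddChar G ℂ, ‖weylCoeff M x.1 x.2‖ ^ 2 ≤ ‖M‖ ^ 2 := by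
    rw [Fintype.sum_prod_type]
    simp only [hparseval]
    rw [← Finset.mul_sum, Finset.sum_comm, inv_mul_le_iff₀ hcard]
    calc ∑ τ, ∑ a, ‖M (τ + a) τ‖ ^ 2 = ∑ τ, ∑ σ, ‖M σ τ‖ ^ 2 :=
          Finset.sum_congr rfl fun τ _ =>
            Equiv.sum_comp (Equiv.addLeft τ) fun σ => ‖M σ τ‖ ^ 2
      _ ≤ ∑ _τ : G, ‖M‖ ^ 2 := Finset.sum_le_sum fun τ _ => sum_norm_sq_col_le M τ
      _ = _ := by simp
  rw [← Fintype.sum_prod_type' (f := fun a ψ => ‖weylCoeff M a ψ‖)]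
  refine (pow_le_pow_iff_left₀ (by positivity) (by positivity) two_ne_zero).1 ?_
  calc (∑ x : G × AddChar G ℂ, ‖weylCoeff M x.1 x.2‖) ^ 2
      ≤ Fintype.card (G × AddChar G ℂ) * ∑ x : G × AddChar G ℂ, ‖weylCoeff M x.1 x.2‖ ^ 2 :=
        sq_sum_le_card_mul_sum_sq
    _ ≤ (Fintype.card G * Fintype.card G : ℕ) * ‖M‖ ^ 2 := by
        rw [Fintype.card_prod, AddChar.card_eq]
        gcongr
    _ = (Fintype.card G * ‖M‖) ^ 2 := by
        push_cast
        ring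

theorem seminorm_le_of_forall_weyl_le {E : Type*} [AddCommGroup E] [Module ℂ E]
    (p : Seminorm ℂ E) (T : Matrix G G ℂ →ₗ[ℂ] E) {C : ℝ} (hT : ∀ a ψ, p (T (weyl a ψ)) ≤ C)
    (M : Matrix G G ℂ) : p (T M) ≤ Fintype.card G * ‖M‖ * C :=
  calc p (T M) = p (∑ a, ∑ ψ, weylCoeff M a ψ • T (weyl a ψ)) := by
        conv_lhs => rw [← sum_weylCoeff_smul M]
        simp only [map_sum, map_smul]
    _ ≤ ∑ a, ∑ ψ, p (weylCoeff M a ψ • T (weyl a ψ)) :=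
        (seminorm_sum_le p _ _).trans (Finset.sum_le_sum fun a _ => seminorm_sum_le p _ _)
    _ ≤ ∑ a, ∑ ψ, ‖weylCoeff M a ψ‖ * C := by
        simp only [map_smul_eq_mul]
        gcongr
        exact hT _ _
    _ ≤ Fintype.card G * ‖M‖ * C := by
        simp only [← Finset.sum_mul]
        exact mul_le_mul_of_nonneg_right (sum_norm_weylCoeff_le M)
          ((apply_nonneg p _).trans (hT 0 1))

end Weyl

theorem linearMap_ext_weyl {G E : Type*} [AddCommGroup G] [DecidableEq G] [Finite G]
    [AddCommGroup E] [Module ℂ E] {S T : Matrix G G ℂ →ₗ[ℂ] E}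
    (h : ∀ a ψ, S (weyl a ψ) = T (weyl a ψ)) : S = T := by
  cases nonempty_fintype G
  exact LinearMap.ext fun M => by
    rw [← sum_weylCoeff_smul M]
    simp only [map_sum, map_smul, h]

section LocalNet

variable {L : Type u} {N : ℕ} [NeZero N]

/-- Restriction of configurations to a smaller set of sites, additive for the group structure of
`Fin N = ℤ/N`. -/
def restrictHom (N : ℕ) [NeZero N] {Λ Λ' : Finset L} (h : Λ ⊆ Λ') :
    (Λ' → Fin N) →+ (Λ → Fin N) where
  toFun σ x := σ ⟨x.1, h x.2⟩
  map_zero' := rfl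
  map_add' _ _ := rfl

theorem restrictHom_apply {Λ Λ' : Finset L} (h : Λ ⊆ Λ') (σ : Λ' → Fin N) (x : Λ) :
    restrictHom N h σ x = σ ⟨x.1, h x.2⟩ := rfl

variable [DecidableEq L]

/-- Extension of configurations by zero. -/
def extendHom (N : ℕ) [NeZero N] (Λ Λ' : Finset L) : (Λ → Fin N) →+ (Λ' → Fin N) where
  toFun a x := if hx : x.1 ∈ Λ then a ⟨x.1, hx⟩ else 0
  map_zero' := by ext x; simp
  map_add' a b := by
    funext x
    by_cases hx : x.1 ∈ Λ <;> simp [hx]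

theorem extendHom_apply {Λ Λ' : Finset L} (a : Λ → Fin N) (x : Λ') :
    extendHom N Λ Λ' a x = if hx : x.1 ∈ Λ then a ⟨x.1, hx⟩ else 0 := rfl

theorem eq_add_extendHom_iff {Λ Λ' : Finset L} (h : Λ ⊆ Λ') (a : Λ → Fin N) (σ τ : Λ' → Fin N) :
    σ = τ + extendHom N Λ Λ' a ↔
      (∀ x : Λ', x.1 ∉ Λ → σ x = τ x) ∧ restrictHom N h σ = restrictHom N h τ + a := by
  constructor
  · rintro rfl
    refine ⟨fun x hx => ?_, funext fun x => ?_⟩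
    · simp [extendHom_apply, hx]
    · simp [extendHom_apply, restrictHom_apply]
  · rintro ⟨hout, hin⟩
    funext x
    by_cases hx : x.1 ∈ Λ
    · simpa [extendHom_apply, restrictHom_apply, hx] using congrFun hin ⟨x.1, hx⟩
    · simpa [extendHom_apply, hx] using hout x hx

theorem extend_weyl {Λ Λ' : Finset L} (h : Λ ⊆ Λ') (a : Λ → Fin N) (ψ : AddChar (Λ → Fin N) ℂ) :
    extend h (weyl a ψ) =
      weyl (extendHom N Λ Λ' a) (ψ.compAddMonoidHom (restrictHom N h)) := by
  ext σ τ
  simp only [extend_apply, weyl_apply, eq_add_extendHom_iff h, ite_and]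
  rfl

theorem incl_weyl {Λ Λ' : Finset L} (h : Λ ⊆ Λ') (a : Λ → Fin N) (ψ : AddChar (Λ → Fin N) ℂ) :
    incl Λ (weyl a ψ) =
      incl Λ' (weyl (extendHom N Λ Λ' a) (ψ.compAddMonoidHom (restrictHom N h))) := by
  rw [← extend_weyl h, incl_extend]

theorem restrictHom_extendHom_of_disjoint {X Y Z : Finset L} (hXY : Disjoint X Y) (hX : X ⊆ Z)
    (b : Y → Fin N) : restrictHom N hX (extendHom N Y Z b) = 0 := by
  funext x
  simp [restrictHom_apply, extendHom_apply, Finset.disjoint_left.1 hXY x.2]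

theorem commute_incl_weyl {X Y : Finset L} (hXY : Disjoint X Y) (a : X → Fin N)
    (ψ : AddChar (X → Fin N) ℂ) (b : Y → Fin N) (χ : AddChar (Y → Fin N) ℂ) :
    Commute (incl X (weyl a ψ)) (incl Y (weyl b χ)) := by
  have hX : X ⊆ X ∪ Y := Finset.subset_union_left
  have hY : Y ⊆ X ∪ Y := Finset.subset_union_right
  rw [incl_weyl hX a ψ, incl_weyl hY b χ, commute_iff_eq, ← map_mul, ← map_mul,
    weyl_mul_comm (extendHom N X _ a), AddChar.compAddMonoidHom_apply,
    AddChar.compAddMonoidHom_apply, map_neg, restrictHom_extendHom_of_disjoint hXY,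
    restrictHom_extendHom_of_disjoint hXY.symm, neg_zero, AddChar.map_zero_eq_one,
    AddChar.map_zero_eq_one, mul_one, one_smul]

theorem commute_incl {X Y : Finset L} (hXY : Disjoint X Y) (A : BoxAlgebra N X)
    (B : BoxAlgebra N Y) : Commute (incl X A) (incl Y B) := by
  have hweyl : ∀ a ψ, Commute (incl X (weyl a ψ)) (incl Y B) := fun a ψ =>
    LinearMap.congr_fun (linearMap_ext_weyl
      (S := LinearMap.mulLeft ℂ (incl X (weyl a ψ)) ∘ₗ (incl Y).toLinearMap)
      (T := LinearMap.mulRight ℂ (incl X (weyl a ψ)) ∘ₗ (incl Y).toLinearMap)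
      (commute_incl_weyl hXY a ψ)) B
  exact LinearMap.congr_fun (linearMap_ext_weyl
    (S := LinearMap.mulRight ℂ (incl Y B) ∘ₗ (incl X).toLinearMap)
    (T := LinearMap.mulLeft ℂ (incl Y B) ∘ₗ (incl X).toLinearMap) hweyl) A

/-- The observables local in `Y`, as a subalgebra of the quasi-local algebra. -/
def localNet (N : ℕ) [NeZero N] (Y : Finset L) : Subalgebra ℂ (QuasiLocalAlgebra L N) :=
  (incl Y).toAlgHom.range

theorem incl_mem_localNet (Y : Finset L) (A : BoxAlgebra N Y) : incl Y A ∈ localNet N Y :=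
  ⟨A, rfl⟩

theorem mem_localObservables {a : QuasiLocalAlgebra L N} :
    a ∈ localObservables L N ↔ ∃ Y, a ∈ localNet N Y := by
  constructor
  · rintro ⟨b, rfl⟩
    obtain ⟨Λ, A, rfl⟩ := LocalAlgebra.exists_mk b
    exact ⟨Λ, A, rfl⟩
  · rintro ⟨Y, A, rfl⟩
    exact ⟨_, rfl⟩

theorem dense_iUnion_localNet :
    Dense (⋃ Y : Finset L, (localNet N Y : Set (QuasiLocalAlgebra L N))) := by
  have hunion : ⋃ Y : Finset L, (localNet N Y : Set (QuasiLocalAlgebra L N)) =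
      localObservables L N := by
    ext a
    simp [mem_localObservables]
  exact hunion ▸ QuasiLocalAlgebra.denseRange_ofLocal

end LocalNet

namespace Interaction

variable {L : Type u} [DecidableEq L] {N : ℕ} (Φ : Interaction L N)

theorem sum_enorm_op_le (r : ℝ≥0) (x : L) {S : Finset (Finset L)} (hS : ∀ X ∈ S, x ∈ X) :
    ∑ X ∈ S, ‖Φ.op X‖ₑ * (r : ℝ≥0∞) ^ X.card ≤ Φ.norm r := by
  rw [← Finset.sum_subtype_of_mem (p := (x ∈ ·)) (fun X => ‖Φ.op X‖ₑ * (r : ℝ≥0∞) ^ X.card) hS]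
  exact (ENNReal.sum_le_tsum _).trans (le_iSup_of_le x le_rfl)

variable [NeZero N]

/-- The operator `Φ_X`, as an element of the quasi-local algebra. -/
def term (X : Finset L) : QuasiLocalAlgebra L N :=
  incl X (Φ.op X)

theorem isLocalInteraction : IsLocalInteraction (localNet N) Φ.term where
  mono h := by
    rintro _ ⟨A, rfl⟩
    exact ⟨extend h A, incl_extend h A⟩
  commute := by
    rintro X Y hXY _ ⟨A, rfl⟩ _ ⟨B, rfl⟩
    exact commute_incl hXY A B
  mem X := incl_mem_localNet X _

theorem isSelfAdjoint_term (X : Finset L) : IsSelfAdjoint (Φ.term X) :=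
  IsSelfAdjoint.map (Φ.isHermitian X) (incl X)

theorem norm_term (X : Finset L) : ‖Φ.term X‖ = ‖Φ.op X‖ :=
  norm_incl X _

theorem weightBound {m r κ : ℝ≥0} (h : 2 * Φ.norm (m * r) ≤ κ) :
    WeightBound (fun X => 2 * (‖Φ.term X‖ * (m : ℝ) ^ X.card)) r κ where
  nonneg X := by positivity
  sum_le x S hS := by
    have hsum : ((∑ X ∈ S, 2 * (‖Φ.op X‖₊ * m ^ X.card) * r ^ X.card : ℝ≥0) : ℝ≥0∞) ≤ κ :=
      calc _ = 2 * ∑ X ∈ S, ‖Φ.op X‖ₑ * ((m * r : ℝ≥0) : ℝ≥0∞) ^ X.card := by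
            rw [Finset.mul_sum]
            push_cast
            refine Finset.sum_congr rfl fun X _ => ?_
            rw [mul_pow, enorm_eq_nnnorm]
            ring
        _ ≤ 2 * Φ.norm (m * r) := by
            gcongr
            exact Φ.sum_enorm_op_le _ x hS
        _ ≤ κ := h
    simp only [norm_term]
    simpa using NNReal.coe_le_coe.2 (ENNReal.coe_le_coe.1 hsum)

end Interaction

section WeylOperators

variable {L : Type u} [DecidableEq L] {N : ℕ} [NeZero N]

/-- The Weyl operators of the quasi-local algebra, with phases. -/
def weylMonoid (L : Type u) [DecidableEq L] (N : ℕ) [NeZero N] :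
    Submonoid (QuasiLocalAlgebra L N) where
  carrier := {w | ∃ (Λ : Finset L) (a : Λ → Fin N) (ψ : AddChar (Λ → Fin N) ℂ) (c : ℂ), ‖c‖ = 1 ∧
    w = c • incl Λ (weyl a ψ)}
  one_mem' := ⟨∅, 0, 1, 1, norm_one, by rw [weyl_zero_one, map_one, one_smul]⟩
  mul_mem' := by
    rintro _ _ ⟨X, a, ψ, c, hc, rfl⟩ ⟨Y, b, χ, c', hc', rfl⟩
    rw [incl_weyl (Finset.subset_union_left (s₂ := Y)) a ψ,
      incl_weyl (Finset.subset_union_right (s₁ := X)) b χ,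
      smul_mul_smul_comm, ← map_mul, weyl_mul, map_smul, smul_smul]
    exact ⟨_, _, _, _, by simp [hc, hc'], rfl⟩

theorem incl_weyl_mem (Λ : Finset L) (a : Λ → Fin N) (ψ : AddChar (Λ → Fin N) ℂ) :
    incl Λ (weyl a ψ) ∈ weylMonoid L N :=
  ⟨Λ, a, ψ, 1, norm_one, (one_smul _ _).symm⟩

theorem star_mem_weylMonoid {w : QuasiLocalAlgebra L N} (hw : w ∈ weylMonoid L N) :
    star w ∈ weylMonoid L N := by
  obtain ⟨Λ, a, ψ, c, hc, rfl⟩ := hw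
  exact ⟨Λ, -a, ψ⁻¹, star c * ψ a, by simp [hc], by
    rw [star_smul, ← map_star, star_weyl, map_smul, smul_smul]⟩

theorem norm_le_one_of_mem_weylMonoid {w : QuasiLocalAlgebra L N} (hw : w ∈ weylMonoid L N) :
    ‖w‖ ≤ 1 := by
  obtain ⟨Λ, a, ψ, c, hc, rfl⟩ := hw
  rw [norm_smul, hc, one_mul, norm_incl]
  exact norm_weyl_le a ψ

theorem mem_localObservables_of_mem_weylMonoid {w : QuasiLocalAlgebra L N}
    (hw : w ∈ weylMonoid L N) : w ∈ localObservables L N := by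
  obtain ⟨Λ, a, ψ, c, -, rfl⟩ := hw
  exact mem_localObservables.2 ⟨Λ, (localNet N Λ).smul_mem (incl_mem_localNet _ _) c⟩

theorem sum_extendHom_restrictHom {Λ : Finset L} (σ : Λ → Fin N) :
    ∑ x : Λ, extendHom N {x.1} Λ (restrictHom N (Finset.singleton_subset_iff.2 x.2) σ) = σ := by
  funext y
  rw [Finset.sum_apply, Finset.sum_eq_single y]
  · simp [extendHom_apply, restrictHom_apply]
  · intro x _ hxy
    have : y.1 ≠ x.1 := fun h => hxy (Subtype.ext h.symm)
    simp [extendHom_apply, this]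
  · simp

theorem exists_site_of_weyl_ne_one {Λ : Finset L} {a : Λ → Fin N} {ψ : AddChar (Λ → Fin N) ℂ}
    (h : ¬ (a = 0 ∧ ψ = 1)) : ∃ x : Λ, restrictHom N (Finset.singleton_subset_iff.2 x.2) a ≠ 0 ∨
      ψ.compAddMonoidHom (extendHom N {x.1} Λ) ≠ 1 := by
  by_contra! htrivial
  refine h ⟨?_, AddChar.eq_one_iff.2 fun σ => ?_⟩
  · rw [← sum_extendHom_restrictHom a]
    simp [htrivial]
  · rw [← sum_extendHom_restrictHom σ]
    refine (map_sum ψ.toAddMonoidHom _ _).trans ?_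
    exact Finset.sum_eq_zero fun x _ => DFunLike.congr_fun (htrivial x).2 _

theorem exists_site_sum_conj_eq_zero {w : QuasiLocalAlgebra L N} (hw : w ∈ weylMonoid L N)
    (hscalar : ∀ c : ℂ, w ≠ c • 1) :
    ∃ x : L, ∑ b : ({x} : Finset L) → Fin N, ∑ χ : AddChar (({x} : Finset L) → Fin N) ℂ,
      incl {x} (weyl b χ) * w * star (incl {x} (weyl b χ)) = 0 := by
  obtain ⟨Λ, a, ψ, c, -, rfl⟩ := hw
  obtain ⟨x, hx⟩ := exists_site_of_weyl_ne_one (a := a) (ψ := ψ) fun h =>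
    hscalar c (by rw [h.1, h.2, weyl_zero_one, map_one])
  have hxΛ : {x.1} ⊆ Λ := Finset.singleton_subset_iff.2 x.2
  refine ⟨x, ?_⟩
  simp only [incl_weyl hxΛ, ← map_star, mul_smul_comm, smul_mul_assoc, ← map_mul,
    ← Finset.smul_sum, ← map_sum]
  rw [sum_weyl_conj_eq_zero _ _ hx, map_zero, smul_zero]

end WeylOperators

theorem norm_le_of_sum_eq_zero {ι E : Type*} [Fintype ι] [Nonempty ι] [NormedAddCommGroup E]
    [NormedSpace ℝ E] {z : E} {f : ι → E} {ε : ℝ} (hf : ∑ k, f k = 0)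
    (h : ∀ k, ‖z - f k‖ ≤ ε) : ‖z‖ ≤ ε := by
  have hcard : (0 : ℝ) < Fintype.card ι := Nat.cast_pos.2 Fintype.card_pos
  have hsum : ‖∑ k, (z - f k)‖ ≤ Fintype.card ι * ε :=
    (norm_sum_le_of_le _ fun k _ => h k).trans_eq (by simp)
  rw [Finset.sum_sub_distrib, hf, sub_zero, Finset.sum_const, Finset.card_univ,
    ← Nat.cast_smul_eq_nsmul ℝ, norm_smul, Real.norm_natCast] at hsum
  exact le_of_mul_le_mul_left hsum hcard

section WeylSeminorm

attribute [local irreducible] QuasiLocalAlgebra.instCStarAlgebra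

variable {L : Type u} [DecidableEq L] {N : ℕ} [NeZero N] (D : QuasiLocalAlgebra L N →L[ℂ] ℂ)

theorem norm_apply_weyl_mul_mul_le {u v : QuasiLocalAlgebra L N} (hu : u ∈ weylMonoid L N)
    (hv : v ∈ weylMonoid L N) (b : QuasiLocalAlgebra L N) : ‖D (u * b * v)‖ ≤ ‖D‖ * ‖b‖ := by
  refine D.le_opNorm_of_le (norm_mul₃_le.trans ?_)
  calc ‖u‖ * ‖b‖ * ‖v‖ ≤ 1 * ‖b‖ * 1 := by
        gcongr
        exacts [norm_le_one_of_mem_weylMonoid hu, norm_le_one_of_mem_weylMonoid hv]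
    _ = ‖b‖ := by ring

theorem bddAbove_range_norm_apply_weyl (b : QuasiLocalAlgebra L N) :
    BddAbove (Set.range fun k : weylMonoid L N × weylMonoid L N => ‖D (k.1 * b * k.2)‖) :=
  ⟨‖D‖ * ‖b‖, Set.forall_mem_range.2 fun k => norm_apply_weyl_mul_mul_le D k.1.2 k.2.2 b⟩

/-- The seminorm `b ↦ sup |D(u b v)|` over the Weyl operators `u`, `v`. It is invariant under
multiplication by Weyl operators, and in it `𝒜_X` acts by multiplication with norm at most
`N ^ |X|` times the operator norm. -/
def weylSeminorm : Seminorm ℂ (QuasiLocalAlgebra L N) :=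
  Seminorm.of (fun b => ⨆ k : weylMonoid L N × weylMonoid L N, ‖D (k.1 * b * k.2)‖)
    (fun a b => ciSup_le fun k => by
      rw [mul_add, add_mul, map_add]
      exact (norm_add_le _ _).trans (add_le_add
        (le_ciSup (bddAbove_range_norm_apply_weyl D a) k)
        (le_ciSup (bddAbove_range_norm_apply_weyl D b) k)))
    (fun c a => by
      simp only [mul_smul_comm, smul_mul_assoc, map_smul, norm_smul]
      rw [Real.mul_iSup_of_nonneg (norm_nonneg c)])

theorem le_weylSeminorm {u v : QuasiLocalAlgebra L N} (hu : u ∈ weylMonoid L N)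
    (hv : v ∈ weylMonoid L N) (b : QuasiLocalAlgebra L N) : ‖D (u * b * v)‖ ≤ weylSeminorm D b :=
  le_ciSup (bddAbove_range_norm_apply_weyl D b) (⟨u, hu⟩, ⟨v, hv⟩)

theorem norm_apply_weyl_mul_le {u : QuasiLocalAlgebra L N} (hu : u ∈ weylMonoid L N)
    (b : QuasiLocalAlgebra L N) : ‖D (u * b)‖ ≤ weylSeminorm D b := by
  simpa only [mul_one] using le_weylSeminorm D hu (one_mem _) b

theorem weylSeminorm_le {b : QuasiLocalAlgebra L N} {C : ℝ}
    (h : ∀ u ∈ weylMonoid L N, ∀ v ∈ weylMonoid L N, ‖D (u * b * v)‖ ≤ C) :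
    weylSeminorm D b ≤ C :=
  ciSup_le fun k => h _ k.1.2 _ k.2.2

theorem continuous_weylSeminorm : Continuous (weylSeminorm D) := by
  refine Seminorm.continuous_of_le (q := ‖D‖₊ • normSeminorm ℂ _) ?_ fun b =>
    weylSeminorm_le D fun u hu v hv => norm_apply_weyl_mul_mul_le D hu hv b
  exact continuous_norm.const_smul ‖D‖₊

theorem weylSeminorm_weyl_mul_le {w : QuasiLocalAlgebra L N} (hw : w ∈ weylMonoid L N)
    (b : QuasiLocalAlgebra L N) : weylSeminorm D (w * b) ≤ weylSeminorm D b :=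
  weylSeminorm_le D fun u hu v hv => by
    rw [← mul_assoc]
    exact le_weylSeminorm D (mul_mem hu hw) hv b

theorem weylSeminorm_mul_weyl_le {w : QuasiLocalAlgebra L N} (hw : w ∈ weylMonoid L N)
    (b : QuasiLocalAlgebra L N) : weylSeminorm D (b * w) ≤ weylSeminorm D b :=
  weylSeminorm_le D fun u hu v hv => by
    rw [← mul_assoc, mul_assoc]
    exact le_weylSeminorm D hu (mul_mem hw hv) b

theorem weylSeminorm_incl_mul_le {X : Finset L} (A : BoxAlgebra N X) (b : QuasiLocalAlgebra L N) :
    weylSeminorm D (incl X A * b) ≤ ‖incl X A‖ * (N : ℝ) ^ X.card * weylSeminorm D b := by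
  have hle := seminorm_le_of_forall_weyl_le (weylSeminorm D)
    (LinearMap.mulRight ℂ b ∘ₗ (incl X).toLinearMap)
    (fun a ψ => weylSeminorm_weyl_mul_le D (incl_weyl_mem X a ψ) b) A
  refine hle.trans_eq ?_
  rw [norm_incl, Fintype.card_fun, Fintype.card_fin, Fintype.card_coe, Nat.cast_pow,
    mul_comm ((N : ℝ) ^ X.card)]

theorem weylSeminorm_mul_incl_le {X : Finset L} (A : BoxAlgebra N X) (b : QuasiLocalAlgebra L N) :
    weylSeminorm D (b * incl X A) ≤ ‖incl X A‖ * (N : ℝ) ^ X.card * weylSeminorm D b := by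
  have hle := seminorm_le_of_forall_weyl_le (weylSeminorm D)
    (LinearMap.mulLeft ℂ b ∘ₗ (incl X).toLinearMap)
    (fun a ψ => weylSeminorm_mul_weyl_le D (incl_weyl_mem X a ψ) b) A
  refine hle.trans_eq ?_
  rw [norm_incl, Fintype.card_fun, Fintype.card_fin, Fintype.card_coe, Nat.cast_pow,
    mul_comm ((N : ℝ) ^ X.card)]

theorem eq_zero_of_weylSeminorm_one_eq_zero (h : weylSeminorm D 1 = 0) : D = 0 := by
  have hweyl : ∀ w ∈ weylMonoid L N, D w = 0 := fun w hw =>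
    norm_le_zero_iff.1 (by simpa only [mul_one, h] using norm_apply_weyl_mul_le D hw 1)
  have hlocal : Set.EqOn D 0 (⋃ Y : Finset L, (localNet N Y : Set (QuasiLocalAlgebra L N))) := by
    rintro a ha
    obtain ⟨Y, A, rfl⟩ := Set.mem_iUnion.1 ha
    exact LinearMap.congr_fun (linearMap_ext_weyl (S := D.toLinearMap ∘ₗ (incl Y).toLinearMap)
      (T := 0) fun a ψ => hweyl _ (incl_weyl_mem Y a ψ)) A
  exact DFunLike.coe_injective
    (Continuous.ext_on dense_iUnion_localNet D.continuous continuous_zero hlocal)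

variable {D}

theorem norm_apply_weyl_le_of_twisted_trace (hD1 : D 1 = 0) {ε : ℝ} (hε : 0 ≤ ε)
    (h : ∀ x : L, ∀ w ∈ weylMonoid L N, w ∈ localNet N {x} → ∃ W,
      (∀ b ∈ localObservables L N, D (w * b) = D (b * W)) ∧ weylSeminorm D (W - w) ≤ ε)
    {e : QuasiLocalAlgebra L N} (he : e ∈ weylMonoid L N) : ‖D e‖ ≤ ε := by
  by_cases hscalar : ∃ c : ℂ, e = c • 1
  · obtain ⟨c, rfl⟩ := hscalar
    rwa [map_smul, hD1, smul_zero, norm_zero]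
  push Not at hscalar
  obtain ⟨x, hx⟩ := exists_site_sum_conj_eq_zero he hscalar
  have hterm : ∀ b χ, ‖D e - D (incl {x} (weyl b χ) * e * star (incl {x} (weyl b χ)))‖ ≤ ε :=
    fun b χ => by
      have hu := incl_weyl_mem {x} b χ
      have heu := mul_mem he (star_mem_weylMonoid hu)
      obtain ⟨W, hW, hWε⟩ := h x _ hu (incl_mem_localNet _ _)
      have hunit : star (incl {x} (weyl b χ)) * incl {x} (weyl b χ) = 1 := by
        rw [← map_star, ← map_mul, Unitary.star_mul_self_of_mem (weyl_mem_unitary b χ), map_one]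
      have hdiff : D e - D (incl {x} (weyl b χ) * e * star (incl {x} (weyl b χ))) =
          -D (e * star (incl {x} (weyl b χ)) * (W - incl {x} (weyl b χ))) := by
        rw [mul_assoc _ e, hW _ (mem_localObservables_of_mem_weylMonoid heu), mul_sub, map_sub,
          mul_assoc e _ (incl {x} _), hunit, mul_one, neg_sub]
      rw [hdiff, norm_neg]
      exact (norm_apply_weyl_mul_le D heu _).trans hWε
  refine norm_le_of_sum_eq_zero (f := fun k : (({x} : Finset L) → Fin N) ×
    AddChar (({x} : Finset L) → Fin N) ℂ => D (incl {x} (weyl k.1 k.2) * e *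
      star (incl {x} (weyl k.1 k.2)))) ?_ fun k => hterm k.1 k.2
  rw [← map_sum, Fintype.sum_prod_type, hx, map_zero]

theorem eq_zero_of_twisted_trace (hD1 : D 1 = 0) {q : ℝ} (hq0 : 0 ≤ q) (hq : q < 1)
    (h : ∀ x : L, ∀ w ∈ weylMonoid L N, w ∈ localNet N {x} → ∃ W,
      (∀ b ∈ localObservables L N, D (w * b) = D (b * W)) ∧
        weylSeminorm D (W - w) ≤ q * weylSeminorm D 1) : D = 0 := by
  refine eq_zero_of_weylSeminorm_one_eq_zero D ?_
  have hnonneg : 0 ≤ weylSeminorm D 1 := apply_nonneg _ _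
  have hcontract : weylSeminorm D 1 ≤ q * weylSeminorm D 1 :=
    weylSeminorm_le D fun u hu v hv => by
      rw [mul_one]
      exact norm_apply_weyl_le_of_twisted_trace hD1 (by positivity) h (mul_mem hu hv)
  nlinarith

end WeylSeminorm

section PositiveFunctional

variable {𝔄 : Type*} [CStarAlgebra 𝔄] {ρ : 𝔄 →ₗ[ℂ] ℂ}

theorem norm_apply_star_mul_sq_le (hρ : ∀ a, 0 ≤ ρ (star a * a)) (a b : 𝔄) :
    ‖ρ (star a * b)‖ ^ 2 ≤ (ρ (star a * a)).re * (ρ (star b * b)).re := by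
  let _ : PartialOrder 𝔄 := CStarAlgebra.spectralOrder 𝔄
  have _ : StarOrderedRing 𝔄 := CStarAlgebra.spectralOrderedRing 𝔄
  let f : 𝔄 →ₚ[ℂ] ℂ := PositiveLinearMap.mk₀ ρ fun x hx => by
    obtain ⟨b, rfl⟩ := CStarAlgebra.nonneg_iff_eq_star_mul_self.1 hx
    exact hρ b
  have hnorm : ∀ x, ‖f.toPreGNS x‖ ^ 2 = (ρ (star x * x)).re := fun x => by
    rw [← Complex.ofReal_re (‖f.toPreGNS x‖ ^ 2), Complex.ofReal_pow, f.preGNS_norm_sq]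
    rfl
  rw [← hnorm, ← hnorm, ← mul_pow]
  gcongr
  exact norm_inner_le_norm (𝕜 := ℂ) (f.toPreGNS a) (f.toPreGNS b)

theorem re_apply_star_mul_self_le (hρ : ∀ a, 0 ≤ ρ (star a * a)) (a : 𝔄) :
    (ρ (star a * a)).re ≤ ‖a‖ ^ 2 * (ρ 1).re := by
  let _ : PartialOrder 𝔄 := CStarAlgebra.spectralOrder 𝔄
  have _ : StarOrderedRing 𝔄 := CStarAlgebra.spectralOrderedRing 𝔄
  obtain ⟨b, hb⟩ := CStarAlgebra.nonneg_iff_eq_star_mul_self.1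
    (sub_nonneg.2 (CStarAlgebra.star_mul_le_algebraMap_norm_sq (a := a)))
  have hb0 := (Complex.nonneg_iff.1 (hρ b)).1
  rw [← hb, map_sub, Algebra.algebraMap_eq_smul_one, ← Complex.coe_smul, map_smul, Complex.sub_re,
    smul_eq_mul, Complex.re_ofReal_mul] at hb0
  linarith

theorem norm_apply_le_of_positive (hρ : ∀ a, 0 ≤ ρ (star a * a)) (hone : ρ 1 = 1) (a : 𝔄) :
    ‖ρ a‖ ≤ ‖a‖ := by
  have hschwarz := norm_apply_star_mul_sq_le hρ 1 a
  have hle := re_apply_star_mul_self_le hρ a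
  rw [star_one, one_mul, one_mul, hone, Complex.one_re, one_mul] at hschwarz
  rw [hone, Complex.one_re, mul_one] at hle
  exact (sq_le_sq₀ (norm_nonneg _) (norm_nonneg _)).1 (hschwarz.trans hle)

end PositiveFunctional

/-- Tracial states, as functions on a `⋆`-algebra. -/
structure IsTracialState {A : Type*} [Ring A] [StarRing A] (τ : A → ℂ) : Prop where
  nonneg : ∀ a, 0 ≤ τ (star a * a)
  map_one : τ 1 = 1
  map_mul_comm : ∀ a b, τ (a * b) = τ (b * a)

section Gibbs

variable {𝔄 : Type*} [CStarAlgebra 𝔄] {τ : 𝔄 →L[ℂ] ℂ} {H : 𝔄}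

theorem IsTracialState.pos_of_isUnit (hτ : IsTracialState τ) {k : 𝔄} (hk : IsUnit k) :
    0 < τ (star k * k) := by
  obtain ⟨l, hl⟩ := hk.star.exists_right_inv
  have hschwarz := norm_apply_star_mul_sq_le (ρ := (τ : 𝔄 →ₗ[ℂ] ℂ)) hτ.nonneg k l
  simp only [ContinuousLinearMap.coe_coe, hl, hτ.map_one, norm_one, one_pow] at hschwarz
  refine (hτ.nonneg k).lt_of_ne fun hzero => ?_
  rw [← hzero, Complex.zero_re, zero_mul] at hschwarz
  exact absurd hschwarz (by norm_num)

/-- The Gibbs state `ρ(a) = τ(e^{-βH} a) / τ(e^{-βH})` of the Hamiltonian `H` at inverse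
temperature `β`, relative to the tracial state `τ`. -/
def gibbsState (τ : 𝔄 →L[ℂ] ℂ) (H : 𝔄) (β : ℝ) : 𝔄 →L[ℂ] ℂ :=
  (τ (NormedSpace.exp (-(β : ℂ) • H)))⁻¹ •
    (τ ∘L ContinuousLinearMap.mul ℂ 𝔄 (NormedSpace.exp (-(β : ℂ) • H)))

theorem gibbsState_apply (τ : 𝔄 →L[ℂ] ℂ) (H : 𝔄) (β : ℝ) (a : 𝔄) :
    gibbsState τ H β a =
      (τ (NormedSpace.exp (-(β : ℂ) • H)))⁻¹ * τ (NormedSpace.exp (-(β : ℂ) • H) * a) := rfl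

theorem exists_isUnit_exp_neg_smul_eq (hH : IsSelfAdjoint H) (β : ℝ) :
    ∃ k : 𝔄, IsUnit k ∧ star k = k ∧ NormedSpace.exp (-(β : ℂ) • H) = k * k := by
  let _ : NormedAlgebra ℚ 𝔄 := NormedAlgebra.restrictScalars ℚ ℂ _
  have hsa : IsSelfAdjoint (((-(β / 2) : ℝ) : ℂ) • H) := by
    rw [isSelfAdjoint_iff, star_smul, hH.star_eq, Complex.star_def, Complex.conj_ofReal]
  refine ⟨NormedSpace.exp (((-(β / 2) : ℝ) : ℂ) • H), NormedSpace.isUnit_exp _,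
    hsa.exp.star_eq, ?_⟩
  rw [← NormedSpace.exp_add_of_commute (Commute.refl _), ← add_smul]
  congr 2
  push_cast
  ring

theorem gibbsState_one (hτ : IsTracialState τ) (hH : IsSelfAdjoint H) (β : ℝ) :
    gibbsState τ H β 1 = 1 := by
  obtain ⟨k, hk, hks, hexp⟩ := exists_isUnit_exp_neg_smul_eq hH β
  have hpos := hτ.pos_of_isUnit hk
  rw [hks] at hpos
  rw [gibbsState_apply, mul_one, hexp, inv_mul_cancel₀ hpos.ne']

theorem gibbsState_nonneg (hτ : IsTracialState τ) (hH : IsSelfAdjoint H) (β : ℝ) (a : 𝔄) :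
    0 ≤ gibbsState τ H β (star a * a) := by
  obtain ⟨k, -, hks, hexp⟩ := exists_isUnit_exp_neg_smul_eq hH β
  have hZ := hτ.nonneg k
  have hak := hτ.nonneg (a * k)
  have hcyclic : τ (k * k * (star a * a)) = τ (star (a * k) * (a * k)) := by
    rw [mul_assoc, hτ.map_mul_comm, star_mul, hks]
    simp only [mul_assoc]
  rw [hks] at hZ
  rw [gibbsState_apply, hexp, hcyclic]
  exact mul_nonneg (inv_nonneg_of_nonneg hZ) hak

theorem norm_gibbsState_le (hτ : IsTracialState τ) (hH : IsSelfAdjoint H) (β : ℝ) :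
    ‖gibbsState τ H β‖ ≤ 1 :=
  ContinuousLinearMap.opNorm_le_bound _ zero_le_one fun a => by
    rw [one_mul]
    exact norm_apply_le_of_positive (ρ := (gibbsState τ H β : 𝔄 →ₗ[ℂ] ℂ))
      (gibbsState_nonneg hτ hH β) (gibbsState_one hτ hH β) a

theorem gibbsState_mul (hτ : IsTracialState τ) (H : 𝔄) (β : ℝ) (a b : 𝔄) :
    gibbsState τ H β (a * b) = gibbsState τ H β (b * evolution H (Complex.I * β) a) := by
  have hIβ : Complex.I * (Complex.I * β) = -(β : ℂ) := by
    rw [← mul_assoc, Complex.I_mul_I, neg_one_mul]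
  rw [gibbsState_apply, gibbsState_apply, evolution_apply, hIβ]
  set e := NormedSpace.exp (-(β : ℂ) • H)
  set e' := NormedSpace.exp (-(-(β : ℂ) • H))
  have hcancel : e' * e = 1 := by
    let _ : NormedAlgebra ℚ 𝔄 := NormedAlgebra.restrictScalars ℚ ℂ _
    simpa only [mul_one] using (SemiconjBy.one_left (-(β : ℂ) • H)).exp_neg_mul_mul_exp_eq_self
  congr 1
  calc τ (e * (a * b)) = τ (b * e * a) := by
        rw [← mul_assoc, hτ.map_mul_comm, mul_assoc]
    _ = τ (b * (e * a * e') * e) := by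
        rw [mul_assoc b (e * a * e'), mul_assoc (e * a), hcancel, mul_one, mul_assoc]
    _ = τ (e * (b * (e * a * e'))) := hτ.map_mul_comm _ _

end Gibbs

section Trace

variable {L : Type u} [DecidableEq L] {N : ℕ}

/-- The normalized trace on `𝒜_Λ`. -/
def boxTrace (Λ : Finset L) : BoxAlgebra N Λ →ₗ[ℂ] ℂ :=
  (Fintype.card (Λ → Fin N) : ℂ)⁻¹ • Matrix.traceLinearMap (Λ → Fin N) ℂ ℂ

theorem boxTrace_apply (Λ : Finset L) (A : BoxAlgebra N Λ) :
    boxTrace Λ A = (Fintype.card (Λ → Fin N) : ℂ)⁻¹ * A.trace := rfl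

variable [NeZero N]

theorem isTracialState_boxTrace (Λ : Finset L) : IsTracialState (boxTrace (N := N) Λ) where
  nonneg A := mul_nonneg (inv_nonneg_of_nonneg (Nat.cast_nonneg _))
    (Matrix.posSemidef_conjTranspose_mul_self A).trace_nonneg
  map_one := by
    rw [boxTrace_apply, Matrix.trace_one,
      inv_mul_cancel₀ (Nat.cast_ne_zero.2 Fintype.card_ne_zero)]
  map_mul_comm A B := by rw [boxTrace_apply, boxTrace_apply, Matrix.trace_mul_comm]

theorem boxTrace_extend {Λ Λ' : Finset L} (h : Λ ≤ Λ') (A : BoxAlgebra N Λ) :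
    boxTrace Λ' (extend h A) = boxTrace Λ A := by
  have htrace : (extend h A).trace =
      A.trace * (1 : Matrix ({x : Λ' // x.1 ∉ Λ} → Fin N) _ ℂ).trace := by
    rw [← Matrix.trace_kronecker]
    exact Equiv.sum_comp (splitConfig h) fun p =>
      (A ⊗ₖ (1 : Matrix ({x : Λ' // x.1 ∉ Λ} → Fin N) _ ℂ)) p p
  rw [boxTrace_apply, boxTrace_apply, htrace, Matrix.trace_one,
    Fintype.card_congr (splitConfig (N := N) h), Fintype.card_prod, Nat.cast_mul]
  have hcard : (Fintype.card ({x : Λ' // x.1 ∉ Λ} → Fin N) : ℂ) ≠ 0 :=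
    Nat.cast_ne_zero.2 Fintype.card_ne_zero
  field_simp

theorem norm_boxTrace_le (Λ : Finset L) (A : BoxAlgebra N Λ) : ‖boxTrace Λ A‖ ≤ ‖A‖ :=
  norm_apply_le_of_positive (isTracialState_boxTrace Λ).nonneg (isTracialState_boxTrace Λ).map_one A

/-- The normalized trace on the local algebra. -/
def localTrace (L : Type u) [DecidableEq L] (N : ℕ) [NeZero N] : LocalAlgebra L N →L[ℂ] ℂ :=
  LinearMap.mkContinuous
    { toFun := DirectLimit.lift (fun _ _ h => extend h) (fun Λ A => boxTrace Λ A)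
        fun _ _ h A => (boxTrace_extend h A).symm
      map_add' := fun a b => by
        obtain ⟨Λ, A, B, rfl, rfl⟩ := LocalAlgebra.exists_mk₂ a b
        rw [← LocalAlgebra.mk_add]
        exact map_add (boxTrace Λ) A B
      map_smul' := fun c a => by
        obtain ⟨Λ, A, rfl⟩ := LocalAlgebra.exists_mk a
        rw [← LocalAlgebra.mk_smul]
        exact map_smul (boxTrace Λ) c A } 1 fun a => by
    obtain ⟨Λ, A, rfl⟩ := LocalAlgebra.exists_mk a
    rw [one_mul]
    exact norm_boxTrace_le Λ A

theorem localTrace_mk (Λ : Finset L) (A : BoxAlgebra N Λ) :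
    localTrace L N (LocalAlgebra.mk Λ A) = boxTrace Λ A := rfl

theorem isTracialState_localTrace : IsTracialState (localTrace L N) where
  nonneg a := by
    obtain ⟨Λ, A, rfl⟩ := LocalAlgebra.exists_mk a
    rw [← LocalAlgebra.mk_star, ← LocalAlgebra.mk_mul, localTrace_mk]
    exact (isTracialState_boxTrace Λ).nonneg A
  map_one := by
    rw [← LocalAlgebra.mk_one ∅, localTrace_mk, (isTracialState_boxTrace ∅).map_one]
  map_mul_comm a b := by
    obtain ⟨Λ, A, B, rfl, rfl⟩ := LocalAlgebra.exists_mk₂ a b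
    rw [← LocalAlgebra.mk_mul, ← LocalAlgebra.mk_mul, localTrace_mk, localTrace_mk,
      (isTracialState_boxTrace Λ).map_mul_comm]

/-- The inclusion `𝒜₀ → 𝒜` as a linear isometry. -/
def ofLocalₗᵢ (L : Type u) [DecidableEq L] (N : ℕ) [NeZero N] :
    LocalAlgebra L N →ₗᵢ[ℂ] QuasiLocalAlgebra L N where
  toFun := QuasiLocalAlgebra.ofLocal
  map_add' := QuasiLocalAlgebra.ofLocal_add
  map_smul' := QuasiLocalAlgebra.ofLocal_smul
  norm_map' := QuasiLocalAlgebra.norm_ofLocal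

/-- The continuous extension of the normalized trace to the quasi-local algebra. -/
def quasiLocalTrace (L : Type u) [DecidableEq L] (N : ℕ) [NeZero N] :
    QuasiLocalAlgebra L N →L[ℂ] ℂ :=
  (localTrace L N).extend (ofLocalₗᵢ L N).toContinuousLinearMap

theorem quasiLocalTrace_ofLocal (a : LocalAlgebra L N) :
    quasiLocalTrace L N (QuasiLocalAlgebra.ofLocal a) = localTrace L N a :=
  ContinuousLinearMap.extend_eq _ QuasiLocalAlgebra.denseRange_ofLocal
    (ofLocalₗᵢ L N).isometry.isUniformInducing a

open QuasiLocalAlgebra in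
theorem isTracialState_quasiLocalTrace : IsTracialState (quasiLocalTrace L N) where
  nonneg a := by
    induction a using denseRange_ofLocal.induction_on with
    | hp => exact isClosed_le continuous_const (by fun_prop)
    | ih a =>
      rw [← ofLocal_star, ← ofLocal_mul, quasiLocalTrace_ofLocal]
      exact isTracialState_localTrace.nonneg a
  map_one := by
    rw [← ofLocal_one, quasiLocalTrace_ofLocal, isTracialState_localTrace.map_one]
  map_mul_comm a b := by
    refine denseRange_ofLocal.induction_on₂ (p := fun a b => quasiLocalTrace L N (a * b) =
      quasiLocalTrace L N (b * a)) (isClosed_eq (by fun_prop) (by fun_prop)) (fun a b => ?_) a b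
    rw [← ofLocal_mul, ← ofLocal_mul, quasiLocalTrace_ofLocal, quasiLocalTrace_ofLocal,
      isTracialState_localTrace.map_mul_comm]

end Trace

theorem exists_ultrafilter_tendsto_apply {𝕜 E ι : Type*} [NontriviallyNormedField 𝕜]
    [ProperSpace 𝕜] [NormedAddCommGroup E] [NormedSpace 𝕜 E] (F : Filter ι) [F.NeBot] {C : ℝ}
    {ρ : ι → E →L[𝕜] 𝕜} (hρ : ∀ i, ‖ρ i‖ ≤ C) :
    ∃ (U : Ultrafilter ι) (ρ₀ : E →L[𝕜] 𝕜), ↑U ≤ F ∧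
      ∀ a, Tendsto (fun i => ρ i a) U (𝓝 (ρ₀ a)) := by
  have hball : Tendsto (fun i => StrongDual.toWeakDual (ρ i)) (Ultrafilter.of F)
      (𝓟 (WeakDual.toStrongDual ⁻¹' Metric.closedBall (0 : StrongDual 𝕜 E) C)) :=
    tendsto_principal.2 (Eventually.of_forall fun i => mem_closedBall_zero_iff.2 (hρ i))
  obtain ⟨ρ₀, -, hlim⟩ := (WeakDual.isCompact_closedBall 0 C).ultrafilter_le_nhds
    ((Ultrafilter.of F).map fun i => StrongDual.toWeakDual (ρ i)) hball
  exact ⟨Ultrafilter.of F, WeakDual.toStrongDual ρ₀, Ultrafilter.of_le F, fun a =>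
    ((WeakDual.eval_continuous a).tendsto ρ₀).comp hlim⟩

theorem tendsto_clm_apply_of_norm_le {𝕜 E G ι : Type*} [NontriviallyNormedField 𝕜]
    [SeminormedAddCommGroup E] [NormedSpace 𝕜 E] [SeminormedAddCommGroup G] [NormedSpace 𝕜 G]
    {F : Filter ι} {C : ℝ} {T : ι → E →L[𝕜] G} {T₀ : E → G} (hT : ∀ i, ‖T i‖ ≤ C)
    (hlim : ∀ a, Tendsto (fun i => T i a) F (𝓝 (T₀ a))) {b : ι → E} {b₀ : E}
    (hb : Tendsto b F (𝓝 b₀)) : Tendsto (fun i => T i (b i)) F (𝓝 (T₀ b₀)) := by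
  have hequi : Equicontinuous fun i => ⇑(T i) :=
    (LipschitzWith.uniformEquicontinuous _ C.toNNReal fun i =>
      (T i).lipschitz.weaken (NNReal.le_toNNReal_of_coe_le (hT i))).equicontinuous
  exact tendsto_apply_of_equicontinuousAt (hequi b₀) hb (hlim b₀)

section KMS

attribute [local irreducible] QuasiLocalAlgebra.instCStarAlgebra

variable {L : Type u} [DecidableEq L] {N : ℕ} [NeZero N]

theorem IsEvolutionAtImaginaryTime.unique
    {α : ℝ → (QuasiLocalAlgebra L N ≃⋆ₐ[ℂ] QuasiLocalAlgebra L N)} {β : ℝ} (hβ : 0 ≤ β)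
    {A W W' : QuasiLocalAlgebra L N} (h : IsEvolutionAtImaginaryTime α β A W)
    (h' : IsEvolutionAtImaginaryTime α β A W') : W = W' := by
  obtain ⟨f, hf, hfα, rfl⟩ := h
  obtain ⟨g, hg, hgα, rfl⟩ := h'
  have hconvex : Convex ℝ {z : ℂ | 0 ≤ z.im ∧ z.im ≤ β} :=
    (convex_halfSpace_im_ge 0).inter (convex_halfSpace_im_le β)
  have hreal : Tendsto ((↑) : ℝ → ℂ) (𝓝[≠] 0) (𝓝[≠] 0) :=
    Complex.continuous_ofReal.continuousWithinAt.tendsto_nhdsWithin fun t ht =>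
      Complex.ofReal_ne_zero.2 ht
  refine hf.eqOn_of_preconnected_of_frequently_eq hg hconvex.isPreconnected
    (z₀ := 0) (by simp [hβ]) (hreal.frequently (Frequently.of_forall fun t => ?_)) (by simp [hβ])
  rw [hfα, hgα]

theorem IsEvolutionAtImaginaryTime.eq_self
    {α : ℝ → (QuasiLocalAlgebra L N ≃⋆ₐ[ℂ] QuasiLocalAlgebra L N)} (hα : ∀ A, α 0 A = A)
    {A W : QuasiLocalAlgebra L N} (h : IsEvolutionAtImaginaryTime α 0 A W) : W = A := by
  obtain ⟨f, -, hf, rfl⟩ := h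
  simpa [hα] using hf 0

theorem isState_gibbsState {τ : QuasiLocalAlgebra L N →L[ℂ] ℂ} (hτ : IsTracialState τ)
    {H : QuasiLocalAlgebra L N} (hH : IsSelfAdjoint H) (β : ℝ) : IsState (gibbsState τ H β) :=
  ⟨gibbsState_nonneg hτ hH β, gibbsState_one hτ hH β⟩

theorem isState_of_tendsto {ι : Type*} {F : Filter ι} [F.NeBot]
    {σ : ι → QuasiLocalAlgebra L N →L[ℂ] ℂ} {ρ : QuasiLocalAlgebra L N →L[ℂ] ℂ}
    (hσ : ∀ i, IsState (σ i)) (hlim : ∀ A, Tendsto (fun i => σ i A) F (𝓝 (ρ A))) : IsState ρ where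
  nonneg A := ge_of_tendsto (hlim _) (Eventually.of_forall fun i => (hσ i).nonneg A)
  map_one := tendsto_nhds_unique (hlim 1)
    (tendsto_const_nhds.congr fun i => (hσ i).map_one.symm)

theorem IsKMSState.unique_of_contraction
    {α : ℝ → (QuasiLocalAlgebra L N ≃⋆ₐ[ℂ] QuasiLocalAlgebra L N)} {β q : ℝ} (hβ : 0 ≤ β)
    (hq0 : 0 ≤ q) (hq : q < 1)
    (h : ∀ (D : QuasiLocalAlgebra L N →L[ℂ] ℂ) (x : L), ∀ w ∈ weylMonoid L N, w ∈ localNet N {x} →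
      ∀ W, IsEvolutionAtImaginaryTime α β w W → weylSeminorm D (W - w) ≤ q * weylSeminorm D 1)
    {ρ ρ' : QuasiLocalAlgebra L N →L[ℂ] ℂ} (hρ : IsKMSState α β ρ) (hρ' : IsKMSState α β ρ') :
    ρ = ρ' := by
  have hone : (ρ - ρ') 1 = 0 := by
    rw [sub_apply, hρ.isState.map_one, hρ'.isState.map_one, sub_self]
  refine sub_eq_zero.1 (eq_zero_of_twisted_trace hone hq0 hq fun x w hw hwx => ?_)
  have hlocal := mem_localObservables.2 ⟨_, hwx⟩
  obtain ⟨W, hW, hρW⟩ := hρ.kms w hlocal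
  obtain ⟨W', hW', hρW'⟩ := hρ'.kms w hlocal
  obtain rfl := hW.unique hβ hW'
  refine ⟨W, fun b hb => ?_, h _ x w hw hwx W hW⟩
  rw [sub_apply, sub_apply, hρW b hb, hρW' b hb]

theorem IsKMSState.unique_of_zero
    {α : ℝ → (QuasiLocalAlgebra L N ≃⋆ₐ[ℂ] QuasiLocalAlgebra L N)} (hα : ∀ A, α 0 A = A)
    {ρ ρ' : QuasiLocalAlgebra L N →L[ℂ] ℂ} (hρ : IsKMSState α 0 ρ) (hρ' : IsKMSState α 0 ρ') :
    ρ = ρ' := by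
  refine hρ.unique_of_contraction le_rfl le_rfl one_pos (fun D x w _ _ W hW => ?_) hρ'
  rw [hW.eq_self hα, sub_self, map_zero, zero_mul]

end KMS

namespace Interaction

attribute [local irreducible] QuasiLocalAlgebra.instCStarAlgebra

section Dynamics

variable {L : Type u} [DecidableEq L] {N : ℕ} [NeZero N] (Φ : Interaction L N) {r κ β : ℝ}

theorem norm_adCLM_term_le (X : Finset L) (b : QuasiLocalAlgebra L N) :
    ‖adCLM (Φ.term X) b‖ ≤ 2 * ‖Φ.term X‖ * ‖b‖ :=
  seminorm_adCLM_le (normSeminorm ℂ _) (norm_mul_le _)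
    (fun b => (norm_mul_le b _).trans_eq (mul_comm _ _)) b

theorem weylSeminorm_adCLM_term_le (D : QuasiLocalAlgebra L N →L[ℂ] ℂ) (X : Finset L)
    (b : QuasiLocalAlgebra L N) :
    weylSeminorm D (adCLM (Φ.term X) b) ≤
      2 * (‖Φ.term X‖ * (N : ℝ) ^ X.card) * weylSeminorm D b :=
  seminorm_adCLM_le (weylSeminorm D) (weylSeminorm_incl_mul_le D _)
    (weylSeminorm_mul_incl_le D _) b

theorem hasLimitDynamics (hκ : WeightBound (fun X => 2 * ‖Φ.term X‖) r κ) (hκ0 : 0 < κ)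
    (hr : 1 < r) : HasLimitDynamics atTop (boxSum Φ.term) :=
  Φ.isLocalInteraction.hasLimitDynamics Φ.isSelfAdjoint_term dense_iUnion_localNet
    Φ.norm_adCLM_term_le hκ hκ0 hr

theorem boxEvolution_eq_evolution (Λ : Finset L) (t : ℂ) (A : QuasiLocalAlgebra L N) :
    Φ.boxEvolution Λ t A = evolution (boxSum Φ.term Λ) t A :=
  (evolution_apply _ _ _).symm

variable {Φ}

theorem isTimeEvolution (hl : HasLimitDynamics atTop (boxSum Φ.term)) :
    Φ.IsTimeEvolution hl.automorphism where
  map_zero := hl.limitEvolution_zero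
  map_add := hl.limitEvolution_add
  tendsto _ hΛ t A _ := by
    simp only [boxEvolution_eq_evolution]
    exact (hl.tendsto_automorphism t A).comp hΛ

theorem IsTimeEvolution.unique [Countable L]
    {α α' : ℝ → (QuasiLocalAlgebra L N ≃⋆ₐ[ℂ] QuasiLocalAlgebra L N)}
    (h : Φ.IsTimeEvolution α) (h' : Φ.IsTimeEvolution α') : α = α' := by
  obtain ⟨Λ, hΛ⟩ := exists_seq_tendsto (atTop : Filter (Finset L))
  funext t
  refine DFunLike.coe_injective (Continuous.ext_on QuasiLocalAlgebra.denseRange_ofLocal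
    (map_continuous (α t)) (map_continuous (α' t)) fun A hA => ?_)
  exact tendsto_nhds_unique (h.tendsto Λ hΛ t A hA) (h'.tendsto Λ hΛ t A hA)

theorem exists_isEvolutionAtImaginaryTime (hl : HasLimitDynamics atTop (boxSum Φ.term))
    (hκ : WeightBound (fun X => 2 * ‖Φ.term X‖) r κ) (hκ0 : 0 < κ) (hr : 1 < r) (hβ0 : 0 ≤ β)
    (hβ : β < (r - 1) / κ) {A : QuasiLocalAlgebra L N} (hA : A ∈ localObservables L N) :
    ∃ W, IsEvolutionAtImaginaryTime hl.automorphism β A W ∧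
      Tendsto (fun Λ => evolution (boxSum Φ.term Λ) (Complex.I * β) A) atTop (𝓝 W) := by
  obtain ⟨Y, hY⟩ := mem_localObservables.1 hA
  obtain ⟨f, hf, hlim⟩ :=
    Φ.isLocalInteraction.exists_tendsto_strip hl Φ.norm_adCLM_term_le hκ hκ0 hr hY
  have hopen : IsOpen {z : ℂ | |z.im| < (r - 1) / κ} :=
    isOpen_lt Complex.continuous_im.abs continuous_const
  have hstrip : {z : ℂ | 0 ≤ z.im ∧ z.im ≤ β} ⊆ {z : ℂ | |z.im| < (r - 1) / κ} :=
    fun z hz => (abs_of_nonneg hz.1).trans_lt (hz.2.trans_lt hβ)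
  have hreal (t : ℝ) : f t = hl.automorphism t A :=
    tendsto_nhds_unique (hlim t (hstrip (by simpa using hβ0))) (hl.tendsto_automorphism t A)
  exact ⟨f (Complex.I * β), ⟨f, (hf.analyticOnNhd hopen).mono hstrip, hreal, rfl⟩,
    hlim _ (hstrip (by simpa using hβ0))⟩

end Dynamics

section Existence

variable {L : Type u} [DecidableEq L] {N : ℕ} [NeZero N] {Φ : Interaction L N} {β : ℝ}

theorem exists_isKMSState (hl : HasLimitDynamics atTop (boxSum Φ.term))
    (hW : ∀ A ∈ localObservables L N, ∃ W, IsEvolutionAtImaginaryTime hl.automorphism β A W ∧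
      Tendsto (fun Λ => evolution (boxSum Φ.term Λ) (Complex.I * β) A) atTop (𝓝 W)) :
    ∃ ρ, IsKMSState hl.automorphism β ρ := by
  have hτ : IsTracialState (quasiLocalTrace L N) := isTracialState_quasiLocalTrace
  have hle := fun Λ => norm_gibbsState_le hτ (hl.isSelfAdjoint Λ) β
  obtain ⟨U, ρ, hU, hlim⟩ := exists_ultrafilter_tendsto_apply atTop hle
  refine ⟨ρ, isState_of_tendsto (fun Λ => isState_gibbsState hτ (hl.isSelfAdjoint Λ) β) hlim,
    fun A hA => ?_⟩
  obtain ⟨W, hAW, hlimW⟩ := hW A hA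
  refine ⟨W, hAW, fun B _ => tendsto_nhds_unique (hlim (A * B)) ?_⟩
  exact (tendsto_clm_apply_of_norm_le hle hlim ((hlimW.mono_left hU).const_mul B)).congr
    fun Λ => (gibbsState_mul hτ _ β A B).symm

end Existence

section HighTemperature

variable {L : Type u} [DecidableEq L] {N : ℕ} [NeZero N] {Φ : Interaction L N}

theorem weylSeminorm_sub_le (D : QuasiLocalAlgebra L N →L[ℂ] ℂ) {r κ β : ℝ} (hκ0 : 0 ≤ κ)
    (hκ : WeightBound (fun X => 2 * (‖Φ.term X‖ * (N : ℝ) ^ X.card)) r κ) (hβ0 : 0 ≤ β)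
    (hβ : 1 + κ * β ≤ r) {x : L} {w W : QuasiLocalAlgebra L N} (hw : w ∈ weylMonoid L N)
    (hwx : w ∈ localNet N {x})
    (hW : Tendsto (fun Λ => evolution (boxSum Φ.term Λ) (Complex.I * β) w) atTop (𝓝 W)) :
    weylSeminorm D (W - w) ≤ κ * β * weylSeminorm D 1 := by
  have hnorm : ‖Complex.I * (β : ℂ)‖ = β := by simp [abs_of_nonneg hβ0]
  have hle : weylSeminorm D w ≤ weylSeminorm D 1 := by
    simpa only [mul_one] using weylSeminorm_weyl_mul_le D hw 1
  refine le_of_tendsto (((continuous_weylSeminorm D).tendsto _).comp (hW.sub_const w))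
    (Eventually.of_forall fun Λ => ?_)
  have hbox := seminorm_evolution_sub_le Φ.isLocalInteraction (continuous_weylSeminorm D)
    (Φ.weylSeminorm_adCLM_term_le D) hκ hκ0 Λ hwx (hnorm.symm ▸ hβ)
  rw [hnorm, Finset.card_singleton, pow_one, add_sub_cancel_left] at hbox
  exact hbox.trans (mul_le_mul_of_nonneg_left hle (by positivity))

theorem isKMSState_unique (hl : HasLimitDynamics atTop (boxSum Φ.term)) {r κ β : ℝ} (hβ : 0 ≤ β)
    (hκ0 : 0 ≤ κ) (hκβ : κ * β < 1) (hβr : 1 + κ * β ≤ r)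
    (hκ : WeightBound (fun X => 2 * (‖Φ.term X‖ * (N : ℝ) ^ X.card)) r κ)
    (hW : ∀ A ∈ localObservables L N, ∃ W, IsEvolutionAtImaginaryTime hl.automorphism β A W ∧
      Tendsto (fun Λ => evolution (boxSum Φ.term Λ) (Complex.I * β) A) atTop (𝓝 W))
    {ρ ρ' : QuasiLocalAlgebra L N →L[ℂ] ℂ} (hρ : IsKMSState hl.automorphism β ρ)
    (hρ' : IsKMSState hl.automorphism β ρ') : ρ = ρ' := by
  refine hρ.unique_of_contraction hβ (by positivity) hκβ (fun D x w hw hwx W hwW => ?_) hρ'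
  obtain ⟨W', hwW', hlim⟩ := hW w (mem_localObservables_of_mem_weylMonoid hw)
  obtain rfl := hwW.unique hβ hwW'
  exact weylSeminorm_sub_le D hκ0 hκ hβ hβr hw hwx hlim

variable (Φ)

theorem exists_weightBound {m r : ℝ≥0} {K : ℝ≥0∞} (h : 2 * Φ.norm (m * r) < K) :
    ∃ κ : ℝ≥0, 0 < κ ∧ κ < K ∧
      WeightBound (fun X => 2 * (‖Φ.term X‖ * (m : ℝ) ^ X.card)) r κ := by
  obtain ⟨κ, hκ, hκK⟩ := ENNReal.lt_iff_exists_nnreal_btwn.1 h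
  exact ⟨κ, ENNReal.coe_pos.1 (bot_le.trans_lt hκ), hκK, Φ.weightBound hκ.le⟩

theorem exists_weightBound_of_norm_lt_top (hΦ : ∃ r : ℝ≥0, 1 < r ∧ Φ.norm r < ⊤) :
    ∃ r κ : ℝ, 1 < r ∧ 0 < κ ∧ WeightBound (fun X => 2 * ‖Φ.term X‖) r κ := by
  obtain ⟨r, hr, hfin⟩ := hΦ
  obtain ⟨κ, hκ0, -, hκ⟩ := Φ.exists_weightBound (m := 1) (r := r) (K := ⊤)
    (ENNReal.mul_lt_top ENNReal.ofNat_lt_top (by rwa [one_mul]))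
  exact ⟨r, κ, hr, hκ0, by simpa using hκ⟩

theorem exists_weightBound_of_high_temperature {β s : ℝ≥0} (hβ0 : β ≠ 0)
    (hβ : 2 * (β : ℝ≥0∞) * Φ.norm (N * (1 + s)) < s) :
    ∃ κ : ℝ, 0 < κ ∧ κ * β < s ∧
      WeightBound (fun X => 2 * (‖Φ.term X‖ * (N : ℝ) ^ X.card)) (1 + s) κ := by
  have hlt : 2 * Φ.norm (N * (1 + s)) < ((s / β : ℝ≥0) : ℝ≥0∞) := by
    rw [ENNReal.coe_div hβ0, ENNReal.lt_div_iff_mul_lt (Or.inl (by simpa using hβ0))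
      (Or.inl ENNReal.coe_ne_top), mul_right_comm]
    exact hβ
  obtain ⟨κ, hκ0, hκ, hbound⟩ := Φ.exists_weightBound hlt
  rw [ENNReal.coe_lt_coe, lt_div_iff₀ (pos_iff_ne_zero.2 hβ0)] at hκ
  exact ⟨κ, hκ0, mod_cast hκ, by simpa using hbound⟩

theorem exists_weightBounds {β s : ℝ≥0} (hΦ : ∃ r : ℝ≥0, 1 < r ∧ Φ.norm r < ⊤) (hs : s ≤ 1)
    (hβ : 2 * (β : ℝ≥0∞) * Φ.norm (N * (1 + s)) < s) :
    ∃ r κ : ℝ, 1 < r ∧ 0 < κ ∧ WeightBound (fun X => 2 * ‖Φ.term X‖) r κ ∧ β < (r - 1) / κ ∧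
      (β ≠ 0 → κ * β < 1 ∧ WeightBound (fun X => 2 * (‖Φ.term X‖ * (N : ℝ) ^ X.card)) r κ) := by
  rcases eq_or_ne β 0 with rfl | hβ0
  · obtain ⟨r, κ, hr, hκ0, hκ⟩ := Φ.exists_weightBound_of_norm_lt_top hΦ
    exact ⟨r, κ, hr, hκ0, hκ, by simpa using div_pos (sub_pos.2 hr) hκ0, (absurd rfl ·)⟩
  · obtain ⟨κ, hκ0, hκβ, hκ⟩ := Φ.exists_weightBound_of_high_temperature hβ0 hβ
    have hs0 : (0 : ℝ) < s := (by positivity : (0 : ℝ) ≤ κ * β).trans_lt hκβ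
    have hN (X : Finset L) : (1 : ℝ) ≤ (N : ℝ) ^ X.card :=
      one_le_pow₀ (mod_cast NeZero.one_le)
    refine ⟨1 + s, κ, by simpa using hs0, hκ0, hκ.mono (by positivity) (fun X => by positivity)
      fun X => ?_, ?_, fun _ => ⟨hκβ.trans_le (mod_cast hs), hκ⟩⟩
    · exact mul_le_mul_of_nonneg_left (le_mul_of_one_le_right (norm_nonneg _) (hN X)) zero_le_two
    · rwa [add_sub_cancel_left, lt_div_iff₀' hκ0]

theorem exists_high_temperature_parameter (β : ℝ≥0)
    (hβ : (β : ℝ≥0∞) * Φ.norm (N + 1) < (2 * (N : ℝ≥0∞))⁻¹ ∨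
      ∃ s : ℝ≥0, s < 1 / (N : ℝ≥0) ∧ 2 * (β : ℝ≥0∞) * Φ.norm (N * (1 + s)) < s) :
    ∃ s : ℝ≥0, s ≤ 1 ∧ 2 * (β : ℝ≥0∞) * Φ.norm (N * (1 + s)) < s := by
  have hN0 : (N : ℝ≥0) ≠ 0 := NeZero.ne _
  have hN1 : 1 / (N : ℝ≥0) ≤ 1 := by
    rw [one_div]
    exact inv_le_one_of_one_le₀ (mod_cast NeZero.one_le)
  rcases hβ with h | ⟨s, hs, h⟩
  · refine ⟨1 / N, hN1, ?_⟩
    have hdouble := ENNReal.mul_lt_mul_right (a := 2) two_ne_zero ENNReal.ofNat_ne_top h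
    rwa [ENNReal.mul_inv (Or.inl two_ne_zero) (Or.inl ENNReal.ofNat_ne_top), ← mul_assoc,
      ← mul_assoc, ENNReal.mul_inv_cancel two_ne_zero ENNReal.ofNat_ne_top, one_mul,
      ← ENNReal.coe_natCast, ← ENNReal.coe_inv hN0, ← one_div,
      show (N : ℝ≥0) + 1 = N * (1 + 1 / N) by field_simp] at hdouble
  · exact ⟨s, hs.le.trans hN1, h⟩

end HighTemperature

end Interaction

end QuantumLattice

end

open QuantumLattice in
theorem theorem2p1_general {L : Type*} [DecidableEq L] [Countable L] {N : ℕ} [NeZero N]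
    (Φ : Interaction L N) (hΦ : ∃ r : ℝ≥0, 1 < r ∧ Φ.norm r < ⊤) (β s : ℝ≥0) (hs : s ≤ 1)
    (hβ : 2 * (β : ℝ≥0∞) * Φ.norm (N * (1 + s)) < s) :
    ∃ α : ℝ → (QuasiLocalAlgebra L N ≃⋆ₐ[ℂ] QuasiLocalAlgebra L N),
      Φ.IsTimeEvolution α ∧ (∀ α', Φ.IsTimeEvolution α' → α' = α) ∧
        ∃! ρ : QuasiLocalAlgebra L N →L[ℂ] ℂ, IsKMSState α β ρ := by
  obtain ⟨r, κ, hr, hκ0, hκ, hβr, hκN⟩ := Φ.exists_weightBounds hΦ hs hβ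
  have hl := Φ.hasLimitDynamics hκ hκ0 hr
  have hα := Interaction.isTimeEvolution hl
  have hW := fun A (hA : A ∈ localObservables L N) =>
    Interaction.exists_isEvolutionAtImaginaryTime hl hκ hκ0 hr β.2 hβr hA
  obtain ⟨ρ, hρ⟩ := Interaction.exists_isKMSState hl hW
  refine ⟨hl.automorphism, hα, fun _ hα' => hα'.unique hα, ρ, hρ, fun ρ' hρ' => ?_⟩
  rcases eq_or_ne β 0 with rfl | hβ0
  · exact hρ'.unique_of_zero hα.map_zero hρ
  · obtain ⟨hκβ, hκN⟩ := hκN hβ0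
    rw [lt_div_iff₀' hκ0, lt_sub_iff_add_lt'] at hβr
    exact Interaction.isKMSState_unique hl β.2 hκ0.le hκβ hβr.le hκN hW hρ' hρ

theorem theorem2p1 (d N : ℕ) [NeZero N] (Φ : QuantumLattice.Interaction (Fin d → ℤ) N)
    (hΦ : ∃ r : ℝ≥0, 1 < r ∧ Φ.norm r < ⊤) (β : ℝ≥0)
    (hβ : (β : ℝ≥0∞) * Φ.norm (N + 1) < (2 * (N : ℝ≥0∞))⁻¹ ∨
      ∃ s : ℝ≥0, s < 1 / (N : ℝ≥0) ∧ 2 * (β : ℝ≥0∞) * Φ.norm (N * (1 + s)) < s) :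
    ∃ α : ℝ → (QuantumLattice.QuasiLocalAlgebra (Fin d → ℤ) N ≃⋆ₐ[ℂ]
        QuantumLattice.QuasiLocalAlgebra (Fin d → ℤ) N),
      Φ.IsTimeEvolution α ∧ (∀ α', Φ.IsTimeEvolution α' → α' = α) ∧
        ∃! ρ : QuantumLattice.QuasiLocalAlgebra (Fin d → ℤ) N →L[ℂ] ℂ,
          QuantumLattice.IsKMSState α β ρ := by
  obtain ⟨s, hs, hsβ⟩ := Φ.exists_high_temperature_parameter β hβ
  exact theorem2p1_general Φ hΦ β s hs hsβ
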